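/- Let $X=\mathbb{R}^n$ with Lebesgue measure, and write $|N|$ for the exterior Lebesgue measure of a set $N\subset X$ and $B_a=\{x\in X : |x-a|<1\}$. Let $\nu:X\to(0,\infty)$ be a function such that $\liminf_{a\to\infty}\nu(a)=0$ and $$\sup_{a,b\in X,\ |b-a|\le r}\frac{\nu(b)}{\nu(a)}<\infty\qquad\text{for each real } r .$$ Let $\mathcal{F}_\nu$ be the filter of all sets $F\subset X$ whose complement $N=X\setminus F$ satisfies $\limsup_{a\to\infty}\nu(a)^{-1}|N\cap B_a|<\infty$, and let $\mathcal{M}_\nu$ be the set of all operators $\varphi(Q)$ of multiplication on the complex Hilbert space $L^2(X)$ by a bounded Borel function $\varphi:X\to\mathbb{C}$ with $\lim_{\mathcal{F}_\nu}\varphi=0$. Let $S$ be a bounded linear operator on $L^2(X)$ such that: * $S$ is of class $C^u(Q)$, i.e. the map $k\mapsto V_k^{-1}SV_k$ from $\mathbb{R}^n$ to the bounded operators on $L^2(X)$ is norm continuous, where $(V_ku)(x)=e^{i\langle x,k\rangle}u(x)$; * for some $p$ with $1\le p<2$, $S$ is also bounded on $L^p(X)$, i.e. there is a constant $C$ with $\|Su\|_{L^p}\le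 C\|u\|_{L^p}$ for all $u\in L^2(X)\cap L^p(X)$. Then $S$ is left $\mathcal{F}_\nu$-decay preserving: for every $M\in\mathcal{M}_\nu$, the operator $SM$ belongs to the norm closed linear subspace of the bounded operators on $L^2(X)$ generated by the products $M'T$, where $M'\in\mathcal{M}_\nu$ and $T$ is a bounded operator on $L^2(X)$. -/

import Mathlib

open MeasureTheory Filter Topology
open scoped ENNReal NNReal

noncomputable section

namespace WeakDecay

/-! ### Decay improving and decay preserving operators between Banach modules -/

section BanachModules

variable {H K : Type*} [NormedAddCommGroup H] [NormedSpace ℂ H]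
  [NormedAddCommGroup K] [NormedSpace ℂ K]

/-- The norm closed linear subspace of `B(H, K)` generated by the operators `M T`, where `T` is in
`B(H, K)` and `M` is in the multiplier algebra `MK` of `K`: the operators which left vanish at
infinity. -/
def leftVanishing (MK : Set (K →L[ℂ] K)) : Submodule ℂ (H →L[ℂ] K) :=
  (Submodule.span ℂ {A : H →L[ℂ] K | ∃ M ∈ MK, ∃ T : H →L[ℂ] K, A = M ∘L T}).topologicalClosure

/-- `S` is left decay preserving with respect to the multiplier algebras `MH` of `H` and `MK` of
`K` if `S M` left vanishes at infinity for every `M` in `MH`. -/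
def LeftDecayPreserving (MH : Set (H →L[ℂ] H)) (MK : Set (K →L[ℂ] K)) (S : H →L[ℂ] K) : Prop :=
  ∀ M ∈ MH, S ∘L M ∈ leftVanishing (H := H) MK

end BanachModules

/-! ### The Hilbert module `L²(ℝⁿ)` -/

/-- The Euclidean space `ℝⁿ`. -/
abbrev Euc (n : ℕ) : Type := EuclideanSpace ℝ (Fin n)

/-- The complex Hilbert space `L²(ℝⁿ)` for the Lebesgue measure. -/
abbrev L2 (n : ℕ) : Type := Lp ℂ 2 (volume : Measure (Euc n))

/-- `φ` belongs to `B(ℝⁿ)`: it is a bounded Borel function. -/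
structure IsBoundedBorel {n : ℕ} (φ : Euc n → ℂ) : Prop where
  measurable : Measurable φ
  bounded : ∃ C : ℝ, ∀ x, ‖φ x‖ ≤ C

lemma IsBoundedBorel.memLp {n : ℕ} {φ : Euc n → ℂ} (hφ : IsBoundedBorel φ) :
    MemLp φ ∞ (volume : Measure (Euc n)) := by
  obtain ⟨C, hC⟩ := hφ.bounded
  exact memLp_top_of_bound hφ.measurable.aestronglyMeasurable C (.of_forall hC)

/-- The operator `φ(Q)` of multiplication by the bounded Borel function `φ` on `L²(ℝⁿ)`. -/
def mulOp {n : ℕ} (φ : Euc n → ℂ) (hφ : IsBoundedBorel φ) : L2 n →L[ℂ] L2 n :=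
  (ContinuousLinearMap.mul ℂ ℂ).holderL volume ∞ 2 2 (hφ.memLp.toLp φ)

lemma coeFn_mulOp {n : ℕ} {φ : Euc n → ℂ} (hφ : IsBoundedBorel φ) (u : L2 n) :
    mulOp φ hφ u =ᵐ[volume] fun x => φ x * u x := by
  filter_upwards [(ContinuousLinearMap.mul ℂ ℂ).coeFn_holder (r := 2) (hφ.memLp.toLp φ) u,
    hφ.memLp.coeFn_toLp] with x h1 h2
  rw [h2] at h1
  exact h1

/-- The multiplier algebra on `L²(ℝⁿ)` defined by a filter `F`: the operators `φ(Q)`, where `φ` is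
a bounded Borel function which tends to zero along `F`. -/
def multiplierAlgebra {n : ℕ} (F : Filter (Euc n)) : Set (L2 n →L[ℂ] L2 n) :=
  {M | ∃ (φ : Euc n → ℂ) (hφ : IsBoundedBorel φ), Tendsto φ F (𝓝 0) ∧ M = mulOp φ hφ}

/-- `S` is left `F`-decay preserving on `L²(ℝⁿ)`. -/
def LeftFilterDecayPreserving {n : ℕ} (F : Filter (Euc n)) (S : L2 n →L[ℂ] L2 n) : Prop :=
  LeftDecayPreserving (multiplierAlgebra F) (multiplierAlgebra F) S

/-! ### Operators of class `C^u(Q)` -/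

lemma isBoundedBorel_character {n : ℕ} (k : Euc n) :
    IsBoundedBorel fun x : Euc n => Complex.exp (Complex.I * (inner ℝ x k : ℝ)) where
  measurable := by fun_prop
  bounded := ⟨1, fun x => by rw [mul_comm, Complex.norm_exp_ofReal_mul_I]⟩

/-- The unitary operator `(V_k u)(x) = exp(i⟨x, k⟩) u(x)` on `L²(ℝⁿ)`. -/
def V {n : ℕ} (k : Euc n) : L2 n →L[ℂ] L2 n :=
  mulOp _ (isBoundedBorel_character k)

/-- `V_{-k}` is the inverse of `V_k` (apply this to `k` and to `-k`). -/
lemma V_neg_comp_V {n : ℕ} (k : Euc n) : V (-k) ∘L V k = ContinuousLinearMap.id ℂ (L2 n) := by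
  ext1 u
  apply Lp.ext
  filter_upwards [coeFn_mulOp (isBoundedBorel_character (-k)) (V k u),
    coeFn_mulOp (isBoundedBorel_character k) u] with x h1 h2
  change (V (-k) (V k u)) x = u x
  change (V (-k) (V k u)) x = _ at h1
  change (V k u) x = _ at h2
  rw [h1, h2, ← mul_assoc, ← Complex.exp_add]
  simp

/-- `S` is of class `C^u(Q)`: the map `k ↦ V_k⁻¹ S V_k` is continuous for the operator norm. -/
def IsClassCu {n : ℕ} (S : L2 n →L[ℂ] L2 n) : Prop :=
  Continuous fun k : Euc n => V (-k) ∘L S ∘L V k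

/-- `S` belongs to `B(Lᵖ(ℝⁿ))`: its restriction to the dense subspace `L² ∩ Lᵖ` of `Lᵖ` is bounded
for the `Lᵖ` norm (so that it extends to a bounded operator on `Lᵖ`). -/
def BoundedOnLp {n : ℕ} (p : ℝ≥0∞) (S : L2 n →L[ℂ] L2 n) : Prop :=
  ∃ C : ℝ≥0, ∀ u : L2 n, MemLp u p volume →
    eLpNorm (S u) p volume ≤ C * eLpNorm u p volume

/-! ### The filter defined by `ν` -/

/-- `limsup_{a → ∞} ν(a)⁻¹ |N ∩ B_a| < ∞`, where `|·|` is the exterior Lebesgue measure and `B_a`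
is the open unit ball of center `a`. -/
def IsNuSmall {n : ℕ} (ν : Euc n → ℝ) (N : Set (Euc n)) : Prop :=
  limsup (fun a : Euc n => volume (N ∩ Metric.ball a 1) / ENNReal.ofReal (ν a))
    (cocompact (Euc n)) < ∞

lemma isNuSmall_iff {n : ℕ} {ν : Euc n → ℝ} {N : Set (Euc n)} :
    IsNuSmall ν N ↔ ∃ c : ℝ≥0, ∀ᶠ a in cocompact (Euc n),
      volume (N ∩ Metric.ball a 1) / ENNReal.ofReal (ν a) ≤ c := by
  constructor
  · intro h
    obtain ⟨c, hc, hc'⟩ := ENNReal.lt_iff_exists_nnreal_btwn.1 h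
    exact ⟨c, (eventually_lt_of_limsup_lt hc).mono fun _ ha => ha.le⟩
  · rintro ⟨c, hc⟩
    exact lt_of_le_of_lt (limsup_le_of_le (by isBoundedDefault) hc) ENNReal.coe_lt_top

lemma IsNuSmall.mono {n : ℕ} {ν : Euc n → ℝ} {N N' : Set (Euc n)} (h : IsNuSmall ν N)
    (hN : N' ⊆ N) : IsNuSmall ν N' := by
  obtain ⟨c, hc⟩ := isNuSmall_iff.1 h
  exact isNuSmall_iff.2 ⟨c, hc.mono fun a ha => le_trans
    (ENNReal.div_le_div_right (measure_mono (Set.inter_subset_inter_left _ hN)) _) ha⟩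

lemma IsNuSmall.union {n : ℕ} {ν : Euc n → ℝ} {N N' : Set (Euc n)} (h : IsNuSmall ν N)
    (h' : IsNuSmall ν N') : IsNuSmall ν (N ∪ N') := by
  obtain ⟨c, hc⟩ := isNuSmall_iff.1 h
  obtain ⟨c', hc'⟩ := isNuSmall_iff.1 h'
  refine isNuSmall_iff.2 ⟨c + c', ?_⟩
  filter_upwards [hc, hc'] with a ha ha'
  rw [Set.union_inter_distrib_right, ENNReal.coe_add]
  refine le_trans (ENNReal.div_le_div_right (measure_union_le _ _) _) ?_
  rw [ENNReal.add_div]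
  exact add_le_add ha ha'

/-- The filter `F_ν` of the sets whose complement `N` satisfies
`limsup_{a → ∞} ν(a)⁻¹ |N ∩ B_a| < ∞`. -/
def nuFilter {n : ℕ} (ν : Euc n → ℝ) : Filter (Euc n) where
  sets := {F | IsNuSmall ν Fᶜ}
  univ_sets := isNuSmall_iff.2 ⟨0, .of_forall fun a => by simp⟩
  sets_of_superset h hs := h.mono (Set.compl_subset_compl.2 hs)
  inter_sets h h' := by
    change IsNuSmall ν _
    rw [Set.compl_inter]
    exact h.union h'

end WeakDecay

end

/-! Discarding the part of `φ` of modulus less than `δ` costs `O(δ)`, and what remains lives on a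
ν-small set `N`. It therefore suffices to see that `S 1_N` is, up to a small norm error, of the form
`1_{N'} T` with `N'` again ν-small. Two ingredients give this.

Localization (`IsClassCu.exists_hasPropagation`). Formally, averaging `V_{εk}⁻¹ S V_{εk}` over a
probability measure in `k` multiplies the kernel `S(x, y)` by the characteristic function of the
measure at `ε(y - x)`. If that function has compact support, the average has finite propagation. It
tends to `S` in norm as `ε → 0` by the class `C^u(Q)`, and it keeps the `Lᵖ` bound because every
`V_k` is isometric on `Lᵖ`.

Maurey's theorem (`exists_small_set_integral_sq_le`). If `|D| ≤ s`, Hölder's inequality shows that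
`T 1_D` maps `L²` to `Lᵖ`, with the `p`-th power of its norm of order `s^(1 - p/2)`. Khintchine's
inequality extends such a bound to square functions, hence to convex combinations of the `‖Tu‖²`,
and a minimax argument turns estimates off a set depending on the function into an estimate off one
common set. As `p < 2`, a suitable truncation level makes `T 1_D` arbitrarily small in `L²` off a
set of measure at most `c s`, with `c` independent of `D` (`BoundedOnLp.exists_exceptional_set`).

These are combined cube by cube: by finite propagation only the part of `N` near a cube matters
there, its measure is `O(ν)`, and the union of the exceptional sets, each cut down to its cube, is
ν-small (`HasPropagation.exists_isNuSmall`). -/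

noncomputable section

namespace WeakDecay

/-! ### Khintchine's inequality -/

section Khintchine

variable {𝕜 E ι : Type*} [RCLike 𝕜] [NormedAddCommGroup E] [InnerProductSpace 𝕜 E] [DecidableEq ι]

/-- The signed sum of the vectors `a k`, `k ∈ s`, with sign `+` exactly when `k ∈ A`. -/
def signedSum {E ι : Type*} [AddCommGroup E] [DecidableEq ι] (a : ι → E) (s A : Finset ι) : E :=
  ∑ k ∈ s, if k ∈ A then a k else -a k

lemma signedSum_insert_of_subset {a : ι → E} {s A : Finset ι} {b : ι} (hb : b ∉ s) (hA : A ⊆ s) :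
    signedSum a (insert b s) A = signedSum a s A - a b := by
  have : b ∉ A := fun h => hb (hA h)
  simp only [signedSum, Finset.sum_insert hb, if_neg this]
  abel

lemma signedSum_insert_insert {a : ι → E} {s A : Finset ι} {b : ι} (hb : b ∉ s) :
    signedSum a (insert b s) (insert b A) = signedSum a s A + a b := by
  simp only [signedSum, Finset.sum_insert hb, Finset.mem_insert_self, if_true]
  rw [add_comm]
  congr 1
  refine Finset.sum_congr rfl fun k hk => ?_
  have : k ≠ b := fun h => hb (h ▸ hk)
  simp [this]

lemma sum_powerset_signedSum_insert {a : ι → E} {s : Finset ι} {b : ι} (hb : b ∉ s) (f : E → ℝ) :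
    ∑ A ∈ (insert b s).powerset, f (signedSum a (insert b s) A) =
      ∑ A ∈ s.powerset, (f (signedSum a s A - a b) + f (signedSum a s A + a b)) := by
  rw [Finset.sum_powerset_insert hb, ← Finset.sum_add_distrib]
  refine Finset.sum_congr rfl fun A hA => ?_
  rw [signedSum_insert_of_subset hb (Finset.mem_powerset.1 hA), signedSum_insert_insert hb]

-- The mean of the squared norm over all signs: each added vector contributes through the
-- parallelogram law.
include 𝕜 in
lemma sum_norm_signedSum_sq (a : ι → E) (s : Finset ι) :
    ∑ A ∈ s.powerset, ‖signedSum a s A‖ ^ 2 = 2 ^ s.card * ∑ k ∈ s, ‖a k‖ ^ 2 := by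
  induction s using Finset.induction_on with
  | empty => simp [signedSum]
  | insert b s hb ih =>
    rw [sum_powerset_signedSum_insert hb fun x => ‖x‖ ^ 2, Finset.card_insert_of_notMem hb,
      Finset.sum_insert hb]
    have (A : Finset ι) : ‖signedSum a s A - a b‖ ^ 2 + ‖signedSum a s A + a b‖ ^ 2 =
        2 * ‖signedSum a s A‖ ^ 2 + 2 * ‖a b‖ ^ 2 := by
      linarith [parallelogram_law_with_norm 𝕜 (signedSum a s A) (a b)]
    simp only [this, Finset.sum_add_distrib, ← Finset.mul_sum, ih, Finset.sum_const,
      Finset.card_powerset, nsmul_eq_mul]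
    push_cast
    ring

-- The matching fourth moment bound. The constant 3 makes the cross term `12 ‖y‖² ‖x‖²` of `key` fit
-- exactly into the square of the enlarged sum.
include 𝕜 in
lemma sum_norm_signedSum_pow_four_le (a : ι → E) (s : Finset ι) :
    ∑ A ∈ s.powerset, ‖signedSum a s A‖ ^ 4 ≤ 3 * 2 ^ s.card * (∑ k ∈ s, ‖a k‖ ^ 2) ^ 2 := by
  induction s using Finset.induction_on with
  | empty => simp [signedSum]
  | insert b s hb ih =>
    rw [sum_powerset_signedSum_insert hb fun x => ‖x‖ ^ 4, Finset.card_insert_of_notMem hb,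
      Finset.sum_insert hb]
    -- The sum of squares of `‖x‖² + ‖y‖² ± 2 Re⟨x, y⟩` is `2(‖x‖² + ‖y‖²)² + 8 (Re⟨x, y⟩)²`;
    -- Cauchy–Schwarz bounds the last term.
    have key (x y : E) : ‖x - y‖ ^ 4 + ‖x + y‖ ^ 4 ≤
        2 * ‖x‖ ^ 4 + 12 * ‖y‖ ^ 2 * ‖x‖ ^ 2 + 2 * ‖y‖ ^ 4 := by
      have h1 := norm_add_sq (𝕜 := 𝕜) x y
      have h2 := norm_sub_sq (𝕜 := 𝕜) x y
      have h3 : RCLike.re (inner 𝕜 x y) ^ 2 ≤ (‖x‖ * ‖y‖) ^ 2 :=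
        sq_le_sq.2 (((RCLike.abs_re_le_norm _).trans (norm_inner_le_norm x y)).trans
          (le_abs_self _))
      have h4 (z : E) : ‖z‖ ^ 4 = (‖z‖ ^ 2) ^ 2 := by ring
      rw [h4 (x - y), h4 (x + y), h1, h2]
      nlinarith
    refine (Finset.sum_le_sum fun A _ => key _ _).trans ?_
    simp only [Finset.sum_add_distrib, ← Finset.mul_sum, Finset.sum_const, Finset.card_powerset,
      nsmul_eq_mul, sum_norm_signedSum_sq (𝕜 := 𝕜)]
    push_cast
    rw [pow_succ (2 : ℝ)]
    have : (0 : ℝ) < 2 ^ s.card := by positivity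
    nlinarith [mul_nonneg this.le (pow_nonneg (norm_nonneg (a b)) 4)]

/-- A pointwise substitute for Hölder interpolation between moments: it bounds a moment of order `p`
from below by second and fourth moments, uniformly in `p`. -/
lemma rpow_half_lower_bound {p y : ℝ} (hp0 : 0 ≤ p) (hp : p ≤ 2) (hy : 0 ≤ y) :
    (1 / 6) * (y - y ^ 2 / 6) ≤ y ^ (p / 2) := by
  rcases le_or_gt y 1 with h1 | h1
  · have : y ≤ y ^ (p / 2) := by
      conv_lhs => rw [← Real.rpow_one y]
      rcases hy.eq_or_lt with rfl | hy
      · rw [Real.zero_rpow one_ne_zero]; exact Real.rpow_nonneg le_rfl _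
      · exact Real.rpow_le_rpow_of_exponent_ge hy h1 (by linarith)
    nlinarith
  · have : 1 ≤ y ^ (p / 2) := Real.one_le_rpow h1.le (by linarith)
    nlinarith [sq_nonneg (y - 3)]

include 𝕜 in
/-- Khintchine's inequality. -/
lemma khintchine (a : ι → E) (s : Finset ι) {p : ℝ} (hp0 : 0 < p) (hp : p ≤ 2) :
    2 ^ s.card * (∑ k ∈ s, ‖a k‖ ^ 2) ^ (p / 2) ≤
      12 * ∑ A ∈ s.powerset, ‖signedSum a s A‖ ^ p := by
  set σ := ∑ k ∈ s, ‖a k‖ ^ 2 with hσ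
  have hσ0 : 0 ≤ σ := Finset.sum_nonneg fun _ _ => by positivity
  rcases hσ0.eq_or_lt with h0 | h0
  · rw [← h0, Real.zero_rpow (by positivity), mul_zero]
    positivity
  -- With `y = ‖signedSum a s A‖² / σ`, the mean of `y` is 1 and that of `y²` is at most 3, so the
  -- lower bound averages to at least `(1/6)(1 - 3/6) = 1/12`.
  have h1 : ∀ A ∈ s.powerset, (1 / 6) * (‖signedSum a s A‖ ^ 2 / σ -
      ‖signedSum a s A‖ ^ 4 / σ ^ 2 / 6) ≤ ‖signedSum a s A‖ ^ p / σ ^ (p / 2) := by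
    intro A _
    have := rpow_half_lower_bound hp0.le hp (y := ‖signedSum a s A‖ ^ 2 / σ) (by positivity)
    rw [Real.div_rpow (by positivity) hσ0, ← Real.rpow_natCast_mul (norm_nonneg _)] at this
    convert this using 3
    · field_simp
    · push_cast; ring_nf
  have h2 := Finset.sum_le_sum h1
  rw [← Finset.sum_div, ← Finset.mul_sum, Finset.sum_sub_distrib, ← Finset.sum_div,
    ← Finset.sum_div, ← Finset.sum_div, sum_norm_signedSum_sq (𝕜 := 𝕜), ← hσ,
    le_div_iff₀ (by positivity)] at h2
  have h3 := sum_norm_signedSum_pow_four_le (𝕜 := 𝕜) a s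
  rw [← hσ] at h3
  have h4 : (∑ A ∈ s.powerset, ‖signedSum a s A‖ ^ 4) / σ ^ 2 ≤ 3 * 2 ^ s.card := by
    rw [div_le_iff₀ (by positivity)]; exact h3
  have h5 : 2 ^ s.card * σ / σ = (2 : ℝ) ^ s.card := by field_simp
  rw [h5] at h2
  have h6 : 0 < σ ^ (p / 2) := by positivity
  nlinarith

end Khintchine

/-! ### Maurey's factorization theorem for operators on a Hilbert space -/

section Maurey

open scoped RealInnerProductSpace

/-- The minimax theorem for a ball of a Hilbert space and a convex set of affine functionals. -/
lemma exists_forall_sub_inner_le {G : Type*} [NormedAddCommGroup G] [InnerProductSpace ℝ G]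
    [CompleteSpace G] {Y : Set (G × ℝ)} (hY : Convex ℝ Y) {r c : ℝ} (hr : 0 ≤ r)
    (h : ∀ y ∈ Y, ∃ ψ : G, ‖ψ‖ ≤ r ∧ y.2 - ⟪ψ, y.1⟫ ≤ c) :
    ∃ ψ : G, ‖ψ‖ ≤ r ∧ ∀ y ∈ Y, y.2 - ⟪ψ, y.1⟫ ≤ c := by
  by_contra! hcon
  -- The ball is taken in the weak-* topology, where it is compact; Riesz representation identifies
  -- it with the ball of `G`.
  let X : Set (WeakDual ℝ G) := WeakDual.toStrongDual ⁻¹' Metric.closedBall 0 r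
  have kX : IsCompact X := WeakDual.isCompact_closedBall 0 r
  have cX : Convex ℝ X :=
    (convex_closedBall (0 : StrongDual ℝ G) r).linear_preimage
      (WeakDual.toStrongDual (𝕜 := ℝ) (E := G)).toLinearMap
  have ne_X : X.Nonempty := ⟨0, by simp [X, hr]⟩
  let f : WeakDual ℝ G → G × ℝ → ℝ := fun l y => y.2 - l y.1
  have hcf (y : G × ℝ) : Continuous fun l => f l y :=
    continuous_const.sub (WeakDual.eval_continuous y.1)
  have hcf' (l : WeakDual ℝ G) : Continuous fun y => f l y :=
    continuous_snd.sub ((WeakDual.toStrongDual l).continuous.comp continuous_fst)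
  have hpt : ∀ l ∈ X, ∃ y ∈ Y, c < f l y := by
    intro l hl
    obtain ⟨y, hy, hlt⟩ := hcon ((InnerProductSpace.toDual ℝ G).symm (WeakDual.toStrongDual l))
      (by simpa [X] using hl)
    refine ⟨y, hy, ?_⟩
    rw [InnerProductSpace.toDual_symm_apply] at hlt
    exact hlt
  choose! y hyY hy using hpt
  -- By compactness finitely many `y` defeat every point of the ball. Sion's theorem then produces
  -- one `y0` defeating them all, against `h`.
  obtain ⟨s, hs⟩ := kX.elim_nhds_subcover' (fun l _ => {l' | c < f l' (y l)})
    (fun l hl => (isOpen_lt continuous_const (hcf _)).mem_nhds (hy l hl))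
  obtain ⟨y0, hy0, hlt⟩ := Sion.exists_lt_iInf_of_lt_iInf_of_finite (f := f) ne_X kX
    (fun y _ => (hcf y).continuousOn.lowerSemicontinuousOn)
    (fun y _ => by
      refine ConvexOn.quasiconvexOn ⟨cX, fun l _ l' _ a b _ _ hab => le_of_eq ?_⟩
      change y.2 - (a • l y.1 + b • l' y.1) = a • (y.2 - l y.1) + b • (y.2 - l' y.1)
      simp only [smul_eq_mul]
      linear_combination (-y.2) * hab) hY
    (fun l _ => (hcf' l).continuousOn.upperSemicontinuousOn)
    (fun l _ => by
      refine ConcaveOn.quasiconcaveOn ⟨hY, fun y _ y' _ a b _ _ hab => le_of_eq ?_⟩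
      simp only [f, Prod.snd_add, Prod.smul_snd, Prod.fst_add, Prod.smul_fst, map_add, map_smul,
        smul_eq_mul]
      ring) cX
    (s := (fun l : X => y l) '' (s : Set X)) (s.finite_toSet.image _)
    (by rintro _ ⟨l, _, rfl⟩; exact hyY l l.2)
    (t := c) (fun l hl => by
      obtain ⟨i, hi, hlt⟩ := Set.mem_iUnion₂.1 (hs hl)
      exact ⟨y i, ⟨i, hi, rfl⟩, hlt⟩)
  obtain ⟨ψ, hψ, hle⟩ := h y0 hy0
  have := hlt (StrongDual.toWeakDual (InnerProductSpace.toDual ℝ G ψ)) (by simpa [X] using hψ)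
  change c < y0.2 - InnerProductSpace.toDual ℝ G ψ y0.1 at this
  rw [InnerProductSpace.toDual_apply_apply] at this
  linarith

variable {α : Type*} [MeasurableSpace α] {μ : Measure α}

/-- If the functions of a convex family have uniformly small integrals over their sublevel sets,
then they have uniformly small integrals outside of a common small set. -/
lemma exists_common_exceptional_set {𝒢 : Set (α → ℝ)} (hconv : Convex ℝ 𝒢)
    (hind : ∀ g ∈ 𝒢, ∀ A, MeasurableSet A → A.indicator g ∈ 𝒢)
    (hmeas : ∀ g ∈ 𝒢, Measurable g) (hpos : ∀ g ∈ 𝒢, 0 ≤ g) (hint : ∀ g ∈ 𝒢, Integrable g μ)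
    (hL2 : ∀ g ∈ 𝒢, MemLp g 2 μ) {t m c : ℝ} (hm : 0 ≤ m)
    (hlarge : ∀ g ∈ 𝒢, μ {x | t < g x} ≤ ENNReal.ofReal m)
    (hsmall : ∀ g ∈ 𝒢, ∫ x in {x | t < g x}ᶜ, g x ∂μ ≤ c) :
    ∃ E, MeasurableSet E ∧ μ E ≤ ENNReal.ofReal (4 * m) ∧
      ∀ g ∈ 𝒢, ∫ x in Eᶜ, g x ∂μ ≤ 2 * c := by
  -- The total integral is carried as a second coordinate, since it need not be continuous for the
  -- `L²` norm.
  let Y : Set (Lp ℝ 2 μ × ℝ) := {y | ∃ g ∈ 𝒢, y.1 =ᵐ[μ] g ∧ y.2 = ∫ x, g x ∂μ}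
  have hY : Convex ℝ Y := by
    rintro ⟨y, s⟩ ⟨g, hg, hyg, hs⟩ ⟨y', s'⟩ ⟨g', hg', hyg', hs'⟩ a b ha hb hab
    refine ⟨a • g + b • g', hconv hg hg' ha hb hab, ?_, ?_⟩
    · change a • y + b • y' =ᵐ[μ] _
      filter_upwards [Lp.coeFn_add (a • y) (b • y'), Lp.coeFn_smul a y, Lp.coeFn_smul b y', hyg,
        hyg'] with x h1 h2 h3 h4 h5
      rw [h1, Pi.add_apply, h2, h3, Pi.smul_apply, Pi.smul_apply, h4, h5]
      rfl
    · simp only at hs hs'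
      simp only [Prod.snd_add, Prod.smul_snd, Pi.add_apply, Pi.smul_apply]
      rw [integral_add (f := fun x => a • g x) (g := fun x => b • g' x) ((hint g hg).smul a)
        ((hint g' hg').smul b), integral_smul, integral_smul, hs, hs']
  obtain ⟨ψ, hψ, hψY⟩ := exists_forall_sub_inner_le hY (r := √m) (c := c) (Real.sqrt_nonneg m) (by
    rintro ⟨y, s⟩ ⟨g, hg, hyg, rfl⟩
    have hA : MeasurableSet {x | t < g x} := measurableSet_lt measurable_const (hmeas g hg)
    have hA' : μ {x | t < g x} ≠ ∞ := ((hlarge g hg).trans_lt ENNReal.ofReal_lt_top).ne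
    -- For a single `g`, the indicator of its own large set is a suitable `ψ`; minimax makes `ψ`
    -- independent of `g`.
    refine ⟨indicatorConstLp 2 hA hA' 1, ?_, ?_⟩
    · rw [norm_indicatorConstLp two_ne_zero ENNReal.ofNat_ne_top, norm_one, one_mul,
        ENNReal.toReal_ofNat, ← Real.sqrt_eq_rpow]
      exact Real.sqrt_le_sqrt (ENNReal.toReal_le_of_le_ofReal hm (hlarge g hg))
    · rw [L2.inner_indicatorConstLp_one]
      simp only at hyg ⊢
      rw [integral_congr_ae (ae_restrict_of_ae hyg)]
      have := integral_add_compl hA (hint g hg)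
      linarith [hsmall g hg])
  have hψm : Measurable ψ := (Lp.stronglyMeasurable ψ).measurable
  have hE : MeasurableSet {x | 1 / 2 ≤ ψ x} := measurableSet_le measurable_const hψm
  -- Chebyshev in `L²` at level `1/2` gives the factor 4. Outside this set `1 - ψ ≥ 1/2`, which
  -- gives the factor 2.
  refine ⟨{x | 1 / 2 ≤ ψ x}, hE, ?_, ?_⟩
  · have h1 := mul_meas_ge_le_pow_eLpNorm' μ two_ne_zero ENNReal.ofNat_ne_top
      (Lp.aestronglyMeasurable ψ) (ENNReal.ofReal (1 / 2))
    have h2 : {x | 1 / 2 ≤ ψ x} ⊆ {x | ENNReal.ofReal (1 / 2) ≤ ‖ψ x‖ₑ} := by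
      intro x hx
      simp only [Set.mem_ofPred_eq] at hx ⊢
      rw [← ofReal_norm]
      exact ENNReal.ofReal_le_ofReal (hx.trans (Real.le_norm_self _))
    have h3 : eLpNorm ψ 2 μ ≤ ENNReal.ofReal (√m) := by
      rw [← ENNReal.ofReal_toReal (Lp.eLpNorm_ne_top ψ), ← Lp.norm_def]
      exact ENNReal.ofReal_le_ofReal hψ
    have h4 : ENNReal.ofReal (1 / 2) ^ (2 : ℝ) * μ {x | 1 / 2 ≤ ψ x} ≤ ENNReal.ofReal m := by
      calc _ ≤ eLpNorm ψ 2 μ ^ (2 : ℝ) := by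
              refine le_trans ?_ h1
              rw [ENNReal.toReal_ofNat]
              gcongr
        _ ≤ ENNReal.ofReal (√m) ^ (2 : ℝ) := by gcongr
        _ = _ := by
          rw [ENNReal.ofReal_rpow_of_nonneg (Real.sqrt_nonneg _) zero_le_two, Real.rpow_two,
            Real.sq_sqrt hm]
    calc μ {x | 1 / 2 ≤ ψ x}
        = ENNReal.ofReal 4 * (ENNReal.ofReal (1 / 2) ^ (2 : ℝ) * μ {x | 1 / 2 ≤ ψ x}) := by
          rw [← mul_assoc, ENNReal.ofReal_rpow_of_nonneg (by norm_num) zero_le_two,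
            ← ENNReal.ofReal_mul (by norm_num)]
          norm_num
      _ ≤ _ := by
        rw [ENNReal.ofReal_mul (by norm_num : (0 : ℝ) ≤ 4)]
        gcongr
  · intro g hg
    set E := {x | 1 / 2 ≤ ψ x}
    -- Nothing bounds `ψ` by 1, so `(1 - ψ) g` may be negative on `E`; testing with `g` cut off to
    -- `Eᶜ` removes that part.
    have hg' := hind g hg Eᶜ hE.compl
    have h1 := hψY ((hL2 _ hg').toLp, ∫ x, Eᶜ.indicator g x ∂μ)
      ⟨_, hg', (hL2 _ hg').coeFn_toLp, rfl⟩
    simp only [L2.inner_def] at h1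
    have h2 : ∫ x, ⟪ψ x, (hL2 _ hg').toLp _ x⟫ ∂μ ≤ ∫ x, 1 / 2 * Eᶜ.indicator g x ∂μ := by
      refine integral_mono_ae (L2.integrable_inner _ _) ((hint _ hg').const_mul _) ?_
      filter_upwards [(hL2 _ hg').coeFn_toLp] with x hx
      rw [hx]
      by_cases hxE : x ∈ E
      · simp [hxE]
      · have h3 : ψ x < 1 / 2 := not_le.1 hxE
        have h4 := hpos g hg x
        simp only [Pi.zero_apply] at h4
        simp only [hxE, Set.mem_compl_iff, not_false_eq_true, Set.indicator_of_mem,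
          RCLike.inner_apply, conj_trivial]
        nlinarith
    rw [integral_const_mul] at h2
    rw [integral_indicator hE.compl] at h1 h2
    linarith

variable {H : Type*} [NormedAddCommGroup H] [InnerProductSpace ℂ H]

lemma coeFn_signedSum {ι : Type*} [DecidableEq ι] (T : H →L[ℂ] Lp ℂ 2 μ) (v : ι → H)
    (s A : Finset ι) :
    T (signedSum v s A) =ᵐ[μ] fun x => signedSum (fun k => T (v k) x) s A := by
  have h : T (signedSum v s A) = ∑ k ∈ s, if k ∈ A then T (v k) else -T (v k) := by
    simp only [signedSum, map_sum]
    refine Finset.sum_congr rfl fun k _ => ?_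
    split_ifs <;> simp
  rw [h]
  refine (Lp.coeFn_finsetSum s _).trans ?_
  have h2 : ∀ k ∈ s, ∀ᵐ x ∂μ, ((if k ∈ A then T (v k) else -T (v k) : Lp ℂ 2 μ) : α → ℂ) x =
      if k ∈ A then T (v k) x else -T (v k) x := by
    intro k _
    split_ifs
    · exact .of_forall fun _ => rfl
    · exact Lp.coeFn_neg _
  filter_upwards [(Finset.eventually_all s).2 h2] with x hx
  rw [Finset.sum_apply]
  exact Finset.sum_congr rfl hx

/-- An operator from a Hilbert space to `Lᵖ` has type 2 square functions. -/
lemma lintegral_square_function_le {ι : Type*} (T : H →L[ℂ] Lp ℂ 2 μ) {p K : ℝ} (hp0 : 0 < p)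
    (hp : p ≤ 2) (hK : 0 ≤ K)
    (hT : ∀ u, ∫⁻ x, ENNReal.ofReal (‖T u x‖ ^ p) ∂μ ≤ ENNReal.ofReal (K * ‖u‖ ^ p))
    (v : ι → H) (s : Finset ι) (hv : ∑ k ∈ s, ‖v k‖ ^ 2 ≤ 1) :
    ∫⁻ x, ENNReal.ofReal ((∑ k ∈ s, ‖T (v k) x‖ ^ 2) ^ (p / 2)) ∂μ ≤ ENNReal.ofReal (24 * K) := by
  classical
  have hN : (0 : ℝ) < 2 ^ s.card := by positivity
  have h1 (x : α) : ENNReal.ofReal ((∑ k ∈ s, ‖T (v k) x‖ ^ 2) ^ (p / 2)) ≤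
      ENNReal.ofReal (12 / 2 ^ s.card) * ∑ A ∈ s.powerset,
        ENNReal.ofReal (‖signedSum (fun k => T (v k) x) s A‖ ^ p) := by
    rw [← ENNReal.ofReal_sum_of_nonneg fun _ _ => by positivity,
      ← ENNReal.ofReal_mul (by positivity)]
    refine ENNReal.ofReal_le_ofReal ?_
    rw [div_mul_eq_mul_div, le_div_iff₀ hN, mul_comm]
    exact khintchine (𝕜 := ℂ) _ s hp0 hp
  have h2 (A : Finset ι) : AEMeasurable
      (fun x => ENNReal.ofReal (‖signedSum (fun k => T (v k) x) s A‖ ^ p)) μ := by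
    have : AEMeasurable (fun x => signedSum (fun k => T (v k) x) s A) μ :=
      (Lp.aestronglyMeasurable _).aemeasurable.congr (coeFn_signedSum T v s A)
    fun_prop
  have h3 (A : Finset ι) : ∫⁻ x, ENNReal.ofReal (‖signedSum (fun k => T (v k) x) s A‖ ^ p) ∂μ ≤
      ENNReal.ofReal (K * (1 + ‖signedSum v s A‖ ^ 2)) := by
    calc _ = ∫⁻ x, ENNReal.ofReal (‖T (signedSum v s A) x‖ ^ p) ∂μ := by
          refine lintegral_congr_ae ?_
          filter_upwards [coeFn_signedSum T v s A] with x hx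
          rw [hx]
      _ ≤ _ := hT _
      _ ≤ _ := by
        -- The bound `r ^ p ≤ 1 + r ^ 2` leaves only second moments, which are known exactly; hence
        -- `12 * (1 + 1) = 24`.
        refine ENNReal.ofReal_le_ofReal (mul_le_mul_of_nonneg_left ?_ hK)
        rcases le_total ‖signedSum v s A‖ 1 with h | h
        · have := Real.rpow_le_one (norm_nonneg _) h hp0.le
          nlinarith [sq_nonneg ‖signedSum v s A‖]
        · have := Real.rpow_le_rpow_of_exponent_le h hp
          rw [Real.rpow_two] at this
          linarith
  calc _ ≤ ∫⁻ x, ENNReal.ofReal (12 / 2 ^ s.card) * ∑ A ∈ s.powerset,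
        ENNReal.ofReal (‖signedSum (fun k => T (v k) x) s A‖ ^ p) ∂μ := lintegral_mono h1
    _ = ENNReal.ofReal (12 / 2 ^ s.card) * ∑ A ∈ s.powerset,
        ∫⁻ x, ENNReal.ofReal (‖signedSum (fun k => T (v k) x) s A‖ ^ p) ∂μ := by
      rw [lintegral_const_mul' _ _ ENNReal.ofReal_ne_top, lintegral_finsetSum' _ fun A _ => h2 A]
    _ ≤ ENNReal.ofReal (12 / 2 ^ s.card) * ∑ A ∈ s.powerset,
        ENNReal.ofReal (K * (1 + ‖signedSum v s A‖ ^ 2)) := by gcongr; exact h3 _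
    _ ≤ _ := by
      rw [← ENNReal.ofReal_sum_of_nonneg fun _ _ => by positivity,
        ← ENNReal.ofReal_mul (by positivity)]
      refine ENNReal.ofReal_le_ofReal ?_
      rw [← Finset.mul_sum, Finset.sum_add_distrib, sum_norm_signedSum_sq (𝕜 := ℂ),
        Finset.sum_const, Finset.card_powerset, nsmul_eq_mul, mul_one]
      push_cast
      rw [div_mul_eq_mul_div, div_le_iff₀ hN]
      have := mul_nonneg hK hN.le
      nlinarith

/-- Convex combinations of the squares `‖T u‖²` with `‖u‖ ≤ 1`. -/
lemma lintegral_rpow_convexHull_le (T : H →L[ℂ] Lp ℂ 2 μ) {p K : ℝ} (hp0 : 0 < p)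
    (hp : p ≤ 2) (hK : 0 ≤ K)
    (hT : ∀ u, ∫⁻ x, ENNReal.ofReal (‖T u x‖ ^ p) ∂μ ≤ ENNReal.ofReal (K * ‖u‖ ^ p))
    {f : α → ℝ} (hf : f ∈ convexHull ℝ {f | ∃ u, ‖u‖ ≤ 1 ∧ f = fun x => ‖T u x‖ ^ 2}) :
    ∫⁻ x, ENNReal.ofReal (f x ^ (p / 2)) ∂μ ≤ ENNReal.ofReal (24 * K) := by
  rw [mem_convexHull_iff_exists_fintype] at hf
  obtain ⟨ι, _, w, z, hw0, hw1, hz, rfl⟩ := hf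
  choose u hu hzu using hz
  -- The weights are absorbed as `w ‖Tu‖² = ‖T(√w u)‖²`, so a convex combination is a square
  -- function.
  have hsum : ∑ k, ‖((√(w k) : ℝ) : ℂ) • u k‖ ^ 2 ≤ 1 := by
    rw [← hw1]
    refine Finset.sum_le_sum fun k _ => ?_
    rw [norm_smul, mul_pow, Complex.norm_real, Real.norm_eq_abs, sq_abs, Real.sq_sqrt (hw0 k)]
    exact mul_le_of_le_one_right (hw0 k) (pow_le_one₀ (norm_nonneg _) (hu k))
  refine le_trans (le_of_eq ?_) (lintegral_square_function_le T hp0 hp hK hT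
    (fun k => ((√(w k) : ℝ) : ℂ) • u k) Finset.univ hsum)
  refine lintegral_congr_ae ?_
  have h : ∀ᵐ x ∂μ, ∀ k, T (((√(w k) : ℝ) : ℂ) • u k) x = ((√(w k) : ℝ) : ℂ) * T (u k) x := by
    refine ae_all_iff.2 fun k => ?_
    rw [map_smul]
    exact Lp.coeFn_smul _ _
  filter_upwards [h] with x hx
  congr 2
  rw [Finset.sum_apply]
  refine Finset.sum_congr rfl fun k _ => ?_
  rw [hx, hzu, norm_mul, mul_pow, Complex.norm_real, Real.norm_eq_abs, sq_abs,
    Real.sq_sqrt (hw0 k)]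
  rfl

/-- A form of Maurey's theorem: an operator from a Hilbert space to `Lᵖ`, `p < 2`, is bounded as an
operator to `L²` outside of a small set. -/
lemma exists_small_set_integral_sq_le (T : H →L[ℂ] Lp ℂ 2 μ) {p K : ℝ} (hp0 : 0 < p)
    (hp : p ≤ 2) (hK : 0 ≤ K)
    (hT : ∀ u, ∫⁻ x, ENNReal.ofReal (‖T u x‖ ^ p) ∂μ ≤ ENNReal.ofReal (K * ‖u‖ ^ p))
    {t : ℝ} (ht : 0 < t) :
    ∃ E, MeasurableSet E ∧ μ E ≤ ENNReal.ofReal (96 * K * t ^ (-(p / 2))) ∧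
      ∀ u, ∫ x in Eᶜ, ‖T u x‖ ^ 2 ∂μ ≤ 48 * K * t ^ (1 - p / 2) * ‖u‖ ^ 2 := by
  set C : Set (α → ℝ) := convexHull ℝ {f | ∃ u, ‖u‖ ≤ 1 ∧ f = fun x => ‖T u x‖ ^ 2} with hC
  -- Passing to functions dominated by the convex hull gives stability under cut-offs; the `L²`
  -- condition is what minimax needs.
  let 𝒢 : Set (α → ℝ) := {g | Measurable g ∧ 0 ≤ g ∧ Integrable g μ ∧ MemLp g 2 μ ∧
    ∃ f ∈ C, g ≤ f}
  have hmeas (u : H) : Measurable (T u) := (Lp.stronglyMeasurable _).measurable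
  have hint (u : H) : Integrable (fun x => ‖T u x‖ ^ 2) μ := 
    (Lp.memLp (T u)).integrable_norm_pow (p := 2) two_ne_zero
  obtain ⟨E, hE, hμE, hEg⟩ := exists_common_exceptional_set (μ := μ) (𝒢 := 𝒢) (t := t)
    (m := 24 * K * t ^ (-(p / 2))) (c := 24 * K * t ^ (1 - p / 2))
    (by
      rintro g ⟨h1, h2, h3, h4, f, hf, h5⟩ g' ⟨h1', h2', h3', h4', f', hf', h5'⟩ a b ha hb hab
      refine ⟨(h1.const_smul a).add (h1'.const_smul b), fun x => ?_,
        (h3.smul a).add (h3'.smul b), (h4.const_smul a).add (h4'.const_smul b),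
        a • f + b • f', convex_convexHull ℝ _ hf hf' ha hb hab, fun x => ?_⟩
      · have := h2 x
        have := h2' x
        simp only [Pi.zero_apply, Pi.add_apply, Pi.smul_apply, smul_eq_mul] at *
        positivity
      · have := h5 x
        have := h5' x
        simp only [Pi.add_apply, Pi.smul_apply, smul_eq_mul]
        gcongr)
    (by
      rintro g ⟨h1, h2, h3, h4, f, hf, h5⟩ A hA
      exact ⟨h1.indicator hA, Set.indicator_nonneg fun x _ => h2 x, h3.indicator hA,
        h4.indicator hA, f, hf, (Set.indicator_le_self' fun x _ => h2 x).trans h5⟩)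
    (fun g hg => hg.1) (fun g hg => hg.2.1) (fun g hg => hg.2.2.1) (fun g hg => hg.2.2.2.1)
    (by positivity)
    (by
      rintro g ⟨h1, h2, h3, h4, f, hf, h5⟩
      -- Chebyshev applied to `g ^ (p / 2)`.
      have h6 := (lintegral_mono fun x => ENNReal.ofReal_le_ofReal (Real.rpow_le_rpow (h2 x)
        (h5 x) (by positivity : 0 ≤ p / 2))).trans
        (lintegral_rpow_convexHull_le T hp0 hp hK hT hf)
      have h7 := mul_meas_ge_le_lintegral₀ (μ := μ) (f := fun x => ENNReal.ofReal (g x ^ (p / 2)))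
        (by fun_prop) (ENNReal.ofReal (t ^ (p / 2)))
      have h8 : {x | t < g x} ⊆
          {x | ENNReal.ofReal (t ^ (p / 2)) ≤ ENNReal.ofReal (g x ^ (p / 2))} := fun x hx =>
        ENNReal.ofReal_le_ofReal (Real.rpow_le_rpow ht.le (le_of_lt hx) (by positivity))
      have h9 := (mul_le_mul_right (measure_mono (μ := μ) h8) (ENNReal.ofReal (t ^ (p / 2)))).trans
        (h7.trans h6)
      calc μ {x | t < g x} = ENNReal.ofReal (t ^ (-(p / 2))) *
            (ENNReal.ofReal (t ^ (p / 2)) * μ {x | t < g x}) := by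
            rw [← mul_assoc, ← ENNReal.ofReal_mul (by positivity), ← Real.rpow_add ht]
            simp
        _ ≤ ENNReal.ofReal (t ^ (-(p / 2))) * ENNReal.ofReal (24 * K) := by gcongr
        _ = _ := by rw [← ENNReal.ofReal_mul (by positivity), mul_comm])
    (by
      rintro g ⟨h1, h2, h3, h4, f, hf, h5⟩
      have h6 := (lintegral_mono fun x => ENNReal.ofReal_le_ofReal (Real.rpow_le_rpow (h2 x)
        (h5 x) (by positivity : 0 ≤ p / 2))).trans
        (lintegral_rpow_convexHull_le T hp0 hp hK hT hf)
      have hA : MeasurableSet {x | t < g x}ᶜ := (measurableSet_lt measurable_const h1).compl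
      rw [integral_eq_lintegral_of_nonneg_ae (.of_forall h2) h1.aestronglyMeasurable]
      refine ENNReal.toReal_le_of_le_ofReal (by positivity) ?_
      -- Where `g ≤ t`, one has `g ≤ t ^ (1 - p / 2) * g ^ (p / 2)`.
      calc ∫⁻ x in {x | t < g x}ᶜ, ENNReal.ofReal (g x) ∂μ
          ≤ ∫⁻ x in {x | t < g x}ᶜ, ENNReal.ofReal (t ^ (1 - p / 2)) *
              ENNReal.ofReal (g x ^ (p / 2)) ∂μ := by
            refine setLIntegral_mono' hA fun x hx => ?_
            have hx : g x ≤ t := not_lt.1 hx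
            rw [← ENNReal.ofReal_mul (by positivity)]
            refine ENNReal.ofReal_le_ofReal ?_
            rcases (h2 x).eq_or_lt with h0 | h0
            · rw [show g x = 0 from h0.symm]
              positivity
            · simp only [Pi.zero_apply] at h0
              calc g x = g x ^ (1 - p / 2) * g x ^ (p / 2) := by rw [← Real.rpow_add h0]; simp
                _ ≤ _ := by
                  gcongr
                  linarith
        _ ≤ ∫⁻ x, ENNReal.ofReal (t ^ (1 - p / 2)) * ENNReal.ofReal (g x ^ (p / 2)) ∂μ :=
            setLIntegral_le_lintegral _ _
        _ = ENNReal.ofReal (t ^ (1 - p / 2)) * ∫⁻ x, ENNReal.ofReal (g x ^ (p / 2)) ∂μ :=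
            lintegral_const_mul' _ _ ENNReal.ofReal_ne_top
        _ ≤ ENNReal.ofReal (t ^ (1 - p / 2)) * ENNReal.ofReal (24 * K) := by gcongr
        _ = _ := by rw [← ENNReal.ofReal_mul (by positivity), mul_comm])
  refine ⟨E, hE, hμE.trans_eq (by ring_nf), ?_⟩
  have hball (u : H) (hu : ‖u‖ ≤ 1) :
      ∫ x in Eᶜ, ‖T u x‖ ^ 2 ∂μ ≤ 48 * K * t ^ (1 - p / 2) := by
    -- `‖Tu‖²` need not be in `L²`, so it is truncated at height `R` to enter `𝒢`, and then `R → ∞`.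
    let s : ℕ → Set α := fun R => Eᶜ ∩ {x | ‖T u x‖ ^ 2 ≤ R}
    have hs' (R : ℕ) : MeasurableSet {x | ‖T u x‖ ^ 2 ≤ (R : ℝ)} :=
      measurableSet_le ((hmeas u).norm.pow_const 2) measurable_const
    have hs (R : ℕ) : MeasurableSet (s R) := hE.compl.inter (hs' R)
    have hU : ⋃ R, s R = Eᶜ := by
      rw [← Set.inter_iUnion]
      refine Set.inter_eq_left.2 fun x _ => ?_
      obtain ⟨R, hR⟩ := exists_nat_ge (‖T u x‖ ^ 2)
      exact Set.mem_iUnion.2 ⟨R, hR⟩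
    have hlim := tendsto_setIntegral_of_monotone (μ := μ) hs
      (fun a b hab => Set.inter_subset_inter_right _ fun x (hx : _ ≤ (a : ℝ)) =>
        hx.trans (by exact_mod_cast hab)) (hint u).integrableOn
    rw [hU] at hlim
    refine le_of_tendsto' hlim fun R => ?_
    have hg : ({x | ‖T u x‖ ^ 2 ≤ (R : ℝ)}.indicator fun x => ‖T u x‖ ^ 2) ∈ 𝒢 := by
      have h1 : Measurable ({x | ‖T u x‖ ^ 2 ≤ (R : ℝ)}.indicator fun x => ‖T u x‖ ^ 2) :=
        ((hmeas u).norm.pow_const 2).indicator (hs' R)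
      have h3 := (hint u).indicator (hs' R)
      refine ⟨h1, Set.indicator_nonneg fun x _ => by positivity, h3, ?_, _,
        subset_convexHull ℝ _ ⟨u, hu, rfl⟩, Set.indicator_le_self' fun x _ => by positivity⟩
      rw [memLp_two_iff_integrable_sq h1.aestronglyMeasurable]
      refine (h3.const_mul (R : ℝ)).mono' (h1.pow_const 2).aestronglyMeasurable
        (.of_forall fun x => ?_)
      rw [Real.norm_of_nonneg (by positivity), sq]
      by_cases hx : ‖T u x‖ ^ 2 ≤ (R : ℝ)
      · simp only [Set.mem_ofPred_eq, hx, Set.indicator_of_mem]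
        gcongr
      · simp [hx]
    have := hEg _ hg
    rw [setIntegral_indicator (hs' R)] at this
    exact this.trans_eq (by ring)
  intro u
  rcases eq_or_ne u 0 with rfl | hu
  · have : ∀ᵐ x ∂μ.restrict Eᶜ, ‖T (0 : H) x‖ ^ 2 = 0 := by
      refine ae_restrict_of_ae ?_
      rw [map_zero]
      filter_upwards [Lp.coeFn_zero ℂ 2 μ] with x hx
      rw [hx, Pi.zero_apply, norm_zero, zero_pow two_ne_zero]
    rw [integral_congr_ae this]
    simp
  · have hu' : 0 < ‖u‖ := norm_pos_iff.2 hu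
    have h1 := hball (((‖u‖⁻¹ : ℝ) : ℂ) • u) (by
      rw [norm_smul, Complex.norm_real, norm_inv, norm_norm, inv_mul_cancel₀ hu'.ne'])
    have h2 : ∀ᵐ x ∂μ.restrict Eᶜ, ‖T (((‖u‖⁻¹ : ℝ) : ℂ) • u) x‖ ^ 2 =
        (‖u‖ ^ 2)⁻¹ * ‖T u x‖ ^ 2 := by
      refine ae_restrict_of_ae ?_
      rw [map_smul]
      filter_upwards [Lp.coeFn_smul ((‖u‖⁻¹ : ℝ) : ℂ) (T u)] with x hx
      rw [hx, Pi.smul_apply, norm_smul, Complex.norm_real, norm_inv, norm_norm, mul_pow, inv_pow]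
    rw [integral_congr_ae h2, integral_const_mul, inv_mul_le_iff₀ (by positivity)] at h1
    linarith

end Maurey

/-! ### A probability measure with compactly supported characteristic function -/

section CharFun

open scoped FourierTransform SchwartzMap ContDiff RealInnerProductSpace

variable {E : Type*} [NormedAddCommGroup E] [InnerProductSpace ℝ E] [FiniteDimensional ℝ E]
  [MeasurableSpace E] [BorelSpace E]

/-- Plancherel applied to `f` and its translate by `y`: the Fourier transform of `|𝓕 f|²` is the
autocorrelation of `f`. -/
lemma integral_exp_mul_norm_fourier_sq (f : 𝓢(E, ℂ)) (hf : HasCompactSupport f) (y : E) :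
    ∫ ξ, Complex.exp ((2 * Real.pi * ⟪ξ, y⟫ : ℝ) * Complex.I) * (‖𝓕 f ξ‖ ^ 2 : ℝ) =
      ∫ x, inner ℂ (f x) (f (x + y)) := by
  have hg1 : HasCompactSupport fun x => f (x + y) :=
    hf.comp_homeomorph (Homeomorph.addRight y)
  have hg2 : ContDiff ℝ ∞ fun x => f (x + y) := f.smooth'.comp (contDiff_id.add contDiff_const)
  let g : 𝓢(E, ℂ) := hg1.toSchwartzMap hg2
  have h := SchwartzMap.integral_inner_fourier_fourier f g
  have hg (ξ : E) : 𝓕 g ξ =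
      Complex.exp ((2 * Real.pi * ⟪ξ, y⟫ : ℝ) * Complex.I) * 𝓕 f ξ := by
    have := congrFun (VectorFourier.fourierIntegral_comp_add_right Real.fourierChar
      (volume : Measure E) (innerₗ E) f y) ξ
    rw [Circle.smul_def, Real.fourierChar_apply, innerₗ_apply_apply, real_inner_comm] at this
    exact this
  refine Eq.trans (integral_congr_ae (.of_forall fun ξ => ?_)) h
  simp only [hg, RCLike.inner_apply, mul_assoc]
  rw [RCLike.mul_conj]
  norm_num

variable (E) in
-- The density is `|𝓕 f|²`, normalized, for a bump `f` supported in the unit ball. Its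
-- characteristic function at `x` is an autocorrelation at `x / 2π`, which vanishes once `‖x / 2π‖ ≥
-- 2`; hence `R = 4π`.
lemma exists_isProbabilityMeasure_charFun_eq_zero :
    ∃ γ : Measure E, IsProbabilityMeasure γ ∧ ∃ R : ℝ, ∀ x, R ≤ ‖x‖ → charFun γ x = 0 := by
  let η : ContDiffBump (0 : E) := ⟨1 / 2, 1, by norm_num, by norm_num⟩
  have hη1 : HasCompactSupport fun x => (η x : ℂ) :=
    η.hasCompactSupport.comp_left Complex.ofReal_zero
  have hη2 : ContDiff ℝ ∞ fun x => (η x : ℂ) := Complex.ofRealCLM.contDiff.comp η.contDiff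
  let f : 𝓢(E, ℂ) := hη1.toSchwartzMap hη2
  have hf (x : E) : f x = η x := rfl
  have hf0 (x : E) (hx : 1 ≤ ‖x‖) : f x = 0 := by
    rw [hf, η.zero_of_le_dist (by simpa using hx), Complex.ofReal_zero]
  set c : ℝ := ∫ ξ, ‖𝓕 f ξ‖ ^ 2 with hc
  have hc0 : 0 < c := by
    rw [hc, SchwartzMap.integral_norm_sq_fourier]
    refine Continuous.integral_pos_of_hasCompactSupport_nonneg_nonzero (x := (0 : E))
      (f.continuous.norm.pow 2) ?_ (fun x => by positivity) ?_
    · exact (hη1.norm).comp_left (g := fun t : ℝ => t ^ 2) (by simp)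
    · rw [hf, η.one_of_mem_closedBall (by simpa using η.rIn_pos.le)]
      simp
  have hint : Integrable fun ξ => ‖𝓕 f ξ‖ ^ 2 := by
    -- A non-integrable function has integral 0 by convention, whereas `c > 0`.
    by_contra h
    exact hc0.ne' (integral_undef h)
  let γ : Measure E := volume.withDensity fun ξ => ENNReal.ofReal (‖𝓕 f ξ‖ ^ 2 / c)
  refine ⟨γ, ⟨?_⟩, 4 * Real.pi, fun x hx => ?_⟩
  · rw [withDensity_apply _ .univ, Measure.restrict_univ,
      ← ofReal_integral_eq_lintegral_ofReal (hint.div_const c) (.of_forall fun _ => by positivity),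
      integral_div, ← hc, div_self hc0.ne', ENNReal.ofReal_one]
  · rw [charFun_apply, integral_withDensity_eq_integral_toReal_smul
      (by fun_prop) (.of_forall fun _ => ENNReal.ofReal_lt_top)]
    have h := integral_exp_mul_norm_fourier_sq f hη1 ((2 * Real.pi)⁻¹ • x)
    have h0 : ∫ z, inner ℂ (f z) (f (z + (2 * Real.pi)⁻¹ • x)) = 0 := by
      refine integral_eq_zero_of_ae (.of_forall fun z => ?_)
      rcases le_or_gt 1 ‖z‖ with hz | hz
      · simp [hf0 z hz]
      · simp only [Pi.zero_apply]
        rw [hf0 (z + _), inner_zero_right]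
        have h2 : 2 ≤ ‖(2 * Real.pi)⁻¹ • x‖ := by
          rw [norm_smul, norm_inv, Real.norm_of_nonneg (by positivity), ← div_eq_inv_mul,
            le_div_iff₀ (by positivity)]
          linarith
        have h3 := norm_sub_le (z + (2 * Real.pi)⁻¹ • x) z
        rw [add_sub_cancel_left] at h3
        linarith
    rw [h0] at h
    rw [← mul_zero (c : ℂ)⁻¹, ← h, ← integral_const_mul]
    refine integral_congr_ae (.of_forall fun ξ => ?_)
    simp only
    rw [ENNReal.toReal_ofReal (by positivity), inner_smul_right, Complex.real_smul]
    have : 2 * Real.pi * ((2 * Real.pi)⁻¹ * ⟪ξ, x⟫) = ⟪ξ, x⟫ := by field_simp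
    rw [this]
    push_cast
    ring

end CharFun

/-! ### Approximation of operators of class `C^u(Q)` by operators of finite propagation -/

/-- Countability of a Hilbert basis is what allows dominated convergence along its finite subsets.
-/
lemma countable_of_orthonormal {𝕜 E ι : Type*} [RCLike 𝕜] [NormedAddCommGroup E]
    [InnerProductSpace 𝕜 E] [TopologicalSpace.SeparableSpace E] {v : ι → E}
    (hv : Orthonormal 𝕜 v) : Countable ι := by
  have h : (Set.univ : Set ι).PairwiseDisjoint fun i => Metric.ball (v i) (1 / 2) := by
    intro i _ j _ hij
    refine Metric.ball_disjoint_ball ?_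
    have h1 := norm_sub_sq (𝕜 := 𝕜) (v i) (v j)
    rw [hv.2 hij, hv.1 i, hv.1 j, map_zero] at h1
    rw [dist_eq_norm]
    nlinarith [norm_nonneg (v i - v j)]
  exact Set.countable_univ_iff.1 (h.countable_of_isOpen (fun _ _ => Metric.isOpen_ball)
    fun i _ => ⟨v i, Metric.mem_ball_self (by norm_num)⟩)

section Propagation

variable {n : ℕ}

lemma coeFn_V (k : Euc n) (u : L2 n) :
    V k u =ᵐ[volume] fun x => Complex.exp (Complex.I * (inner ℝ x k : ℝ)) * u x :=
  coeFn_mulOp _ u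

lemma norm_exp_I_mul (r : ℝ) : ‖Complex.exp (Complex.I * r)‖ = 1 := by
  rw [mul_comm, Complex.norm_exp_ofReal_mul_I]

lemma norm_V_apply_ae (k : Euc n) (u : L2 n) : ∀ᵐ x, ‖V k u x‖ = ‖u x‖ := by
  filter_upwards [coeFn_V k u] with x hx
  rw [hx, norm_mul, norm_exp_I_mul, one_mul]

lemma eLpNorm_V (k : Euc n) (u : L2 n) (p : ℝ≥0∞) :
    eLpNorm (V k u) p volume = eLpNorm u p volume :=
  eLpNorm_congr_norm_ae (norm_V_apply_ae k u)

lemma norm_V_apply (k : Euc n) (u : L2 n) : ‖V k u‖ = ‖u‖ := by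
  rw [Lp.norm_def, Lp.norm_def, eLpNorm_V]

lemma V_zero : V (0 : Euc n) = ContinuousLinearMap.id ℂ (L2 n) := by
  ext1 u
  apply Lp.ext
  filter_upwards [coeFn_V 0 u] with x hx
  rw [hx]
  simp

lemma inner_V_neg (k : Euc n) (a u : L2 n) : inner ℂ a (V (-k) u) = inner ℂ (V k a) u := by
  rw [L2.inner_def, L2.inner_def]
  refine integral_congr_ae ?_
  filter_upwards [coeFn_V (-k) u, coeFn_V k a] with x h1 h2
  rw [h1, h2, RCLike.inner_apply, RCLike.inner_apply, map_mul, ← Complex.exp_conj]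
  simp only [inner_neg_right, map_mul, Complex.conj_I, Complex.conj_ofReal, Complex.ofReal_neg]
  ring_nf

/-- The operator `T` has propagation less than `R`. -/
def HasPropagation (R : ℝ) (T : L2 n →L[ℂ] L2 n) : Prop :=
  ∀ A B : Set (Euc n), MeasurableSet A → MeasurableSet B → (∀ x ∈ A, ∀ y ∈ B, R ≤ dist x y) →
    ∀ u : L2 n, (∀ᵐ x, x ∉ B → u x = 0) → ∀ᵐ x, x ∈ A → T u x = 0

/-- Fubini. This is the effect of averaging on a rank one operator: the kernel gets multiplied by
`charFun γ (ε (y - x))`. -/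
lemma integral_fourier_mul_fourier {γ : Measure (Euc n)} [IsFiniteMeasure γ] {F G : Euc n → ℂ}
    (hF : Integrable F) (hG : Integrable G) (ε : ℝ) :
    ∫ k, (∫ x, Complex.exp (-(Complex.I * (inner ℝ x (ε • k) : ℝ))) * F x) *
        (∫ y, Complex.exp (Complex.I * (inner ℝ y (ε • k) : ℝ)) * G y) ∂γ =
      ∫ z : Euc n × Euc n, F z.1 * G z.2 * charFun γ (ε • (z.2 - z.1)) := by
  have h1 (k : Euc n) : (∫ x, Complex.exp (-(Complex.I * (inner ℝ x (ε • k) : ℝ))) * F x) *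
        (∫ y, Complex.exp (Complex.I * (inner ℝ y (ε • k) : ℝ)) * G y) =
      ∫ z : Euc n × Euc n, F z.1 * G z.2 *
        Complex.exp ((inner ℝ k (ε • (z.2 - z.1)) : ℝ) * Complex.I) := by
    rw [← integral_prod_mul]
    refine integral_congr_ae (.of_forall fun z => ?_)
    simp only
    rw [mul_mul_mul_comm, ← Complex.exp_add, mul_comm]
    congr 2
    rw [inner_smul_right, inner_smul_right, inner_smul_right, inner_sub_right,
      real_inner_comm z.1, real_inner_comm z.2]
    push_cast
    ring
  simp_rw [h1]
  rw [integral_integral_swap]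
  · refine integral_congr_ae (.of_forall fun z => ?_)
    simp only
    rw [integral_const_mul, charFun_apply]
  · have h2 : Integrable (fun w : Euc n × (Euc n × Euc n) => (1 : ℂ) * (F w.2.1 * G w.2.2))
        (γ.prod (volume.prod volume)) :=
      Integrable.mul_prod (integrable_const 1) (hF.mul_prod hG)
    refine h2.mono ?_ (.of_forall fun w => ?_)
    · have := h2.aestronglyMeasurable
      simp only [one_mul] at this
      refine this.mul (Continuous.aestronglyMeasurable ?_)
      fun_prop
    · simp only [Function.uncurry, norm_mul, Complex.norm_exp_ofReal_mul_I, mul_one,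
        one_mul, le_refl]

lemma integrable_star_mul (a b : L2 n) : Integrable fun x => star (a x) * b x := by
  have := L2.integrable_inner (𝕜 := ℂ) a b
  simp only [RCLike.inner_apply, mul_comm (b _)] at this
  exact this

lemma inner_V_left (k : Euc n) (a e : L2 n) : inner ℂ (V k a) e =
    ∫ x, Complex.exp (-(Complex.I * (inner ℝ x k : ℝ))) * (star (a x) * e x) := by
  rw [L2.inner_def]
  refine integral_congr_ae ?_
  filter_upwards [coeFn_V k a] with x h
  rw [h, RCLike.inner_apply, map_mul, ← Complex.exp_conj]
  simp only [map_mul, Complex.conj_I, Complex.conj_ofReal, RCLike.star_def]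
  ring_nf

lemma inner_V_right (k : Euc n) (e u : L2 n) : inner ℂ e (V k u) =
    ∫ x, Complex.exp (Complex.I * (inner ℝ x k : ℝ)) * (star (e x) * u x) := by
  rw [L2.inner_def]
  refine integral_congr_ae ?_
  filter_upwards [coeFn_V k u] with x h
  rw [h, RCLike.inner_apply]
  simp only [RCLike.star_def]
  ring_nf

lemma continuous_inner_V_left (a e : L2 n) : Continuous fun k => inner ℂ (V k a) e := by
  simp_rw [inner_V_left]
  refine continuous_of_dominated (bound := fun x => ‖star (a x) * e x‖) (fun k => ?_)
    (fun k => .of_forall fun x => ?_) (integrable_star_mul a e).norm (.of_forall fun x => ?_)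
  · exact (Continuous.aestronglyMeasurable (by fun_prop)).mul
      (integrable_star_mul a e).aestronglyMeasurable
  · rw [norm_mul, ← mul_neg, ← Complex.ofReal_neg, norm_exp_I_mul, one_mul]
  · fun_prop

lemma continuous_inner_V_right (e u : L2 n) : Continuous fun k => inner ℂ e (V k u) := by
  have := (continuous_inner_V_left u e).star
  simpa only [RCLike.star_def, inner_conj_symm] using this

/-- The average of the operators `V_{εk}⁻¹ S V_{εk}` with respect to a measure whose characteristic
function has compact support has finite propagation. -/
lemma integral_inner_V_eq_zero {γ : Measure (Euc n)} [IsProbabilityMeasure γ] {R ε : ℝ}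
    (hγ : ∀ x, R ≤ ‖x‖ → charFun γ x = 0) (hε : 0 < ε) (S : L2 n →L[ℂ] L2 n)
    {A B : Set (Euc n)} (hAB : ∀ x ∈ A, ∀ y ∈ B, R / ε ≤ dist x y) {a u : L2 n}
    (ha : ∀ᵐ x, x ∉ A → a x = 0) (hu : ∀ᵐ x, x ∉ B → u x = 0) :
    ∫ k, inner ℂ (V (ε • k) a) (S (V (ε • k) u)) ∂γ = 0 := by
  -- A general `S` has no kernel, so rank one operators are treated first; `S` is then expanded
  -- along a Hilbert basis, with Bessel's inequality providing the dominating constant.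
  have hrank (e e' : L2 n) :
      ∫ k, inner ℂ (V (ε • k) a) e * inner ℂ e' (V (ε • k) u) ∂γ = 0 := by
    simp_rw [inner_V_left, inner_V_right]
    rw [integral_fourier_mul_fourier (integrable_star_mul a e) (integrable_star_mul e' u)]
    refine integral_eq_zero_of_ae ?_
    have h1 := (Measure.quasiMeasurePreserving_fst (μ := (volume : Measure (Euc n)))
      (ν := (volume : Measure (Euc n)))).ae ha
    have h2 := (Measure.quasiMeasurePreserving_snd (μ := (volume : Measure (Euc n)))
      (ν := (volume : Measure (Euc n)))).ae hu
    filter_upwards [h1, h2] with z hz1 hz2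
    by_cases hA : z.1 ∈ A
    · by_cases hB : z.2 ∈ B
      · rw [hγ, mul_zero, Pi.zero_apply]
        rw [norm_smul, Real.norm_of_nonneg hε.le, ← div_le_iff₀' hε, ← dist_eq_norm, dist_comm]
        exact hAB _ hA _ hB
      · simp [hz2 hB]
    · simp [hz1 hA]
  obtain ⟨w, b, -⟩ := exists_hilbertBasis ℂ (L2 n)
  have : Fact ((2 : ℝ≥0∞) ≠ ∞) := ⟨ENNReal.ofNat_ne_top⟩
  have : Countable w := countable_of_orthonormal b.orthonormal
  let f : Finset w → Euc n → ℂ := fun s k =>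
    ∑ j ∈ s, inner ℂ (V (ε • k) a) (S (b j)) * inner ℂ (b j) (V (ε • k) u)
  have hfcont (s : Finset w) : Continuous (f s) := by
    refine continuous_finsetSum _ fun j _ => ?_
    have h1 := (continuous_inner_V_left a (S (b j))).comp (continuous_const_smul ε)
    have h2 := (continuous_inner_V_right (b j) u).comp (continuous_const_smul ε)
    exact h1.mul h2
  have hterm (j : w) (k : Euc n) :
      ‖inner ℂ (V (ε • k) a) (S (b j)) * inner ℂ (b j) (V (ε • k) u)‖ ≤
        ‖inner ℂ (b j) (S.adjoint (V (ε • k) a))‖ ^ 2 + ‖inner ℂ (b j) (V (ε • k) u)‖ ^ 2 := by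
    rw [norm_mul, ← ContinuousLinearMap.adjoint_inner_left, norm_inner_symm]
    nlinarith [sq_nonneg (‖inner ℂ (b j) (S.adjoint (V (ε • k) a))‖ -
      ‖inner ℂ (b j) (V (ε • k) u)‖), sq_nonneg (‖inner ℂ (b j) (S.adjoint (V (ε • k) a))‖ +
      ‖inner ℂ (b j) (V (ε • k) u)‖)]
  have hbound (s : Finset w) (k : Euc n) : ‖f s k‖ ≤ (‖S.adjoint‖ * ‖a‖) ^ 2 + ‖u‖ ^ 2 := by
    calc ‖f s k‖ ≤ ∑ j ∈ s, (‖inner ℂ (b j) (S.adjoint (V (ε • k) a))‖ ^ 2 +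
          ‖inner ℂ (b j) (V (ε • k) u)‖ ^ 2) :=
          (norm_sum_le _ _).trans (Finset.sum_le_sum fun j _ => hterm j k)
      _ ≤ ‖S.adjoint (V (ε • k) a)‖ ^ 2 + ‖V (ε • k) u‖ ^ 2 := by
          rw [Finset.sum_add_distrib]
          exact add_le_add (b.orthonormal.sum_inner_products_le _)
            (b.orthonormal.sum_inner_products_le _)
      _ ≤ _ := by
          rw [norm_V_apply]
          gcongr
          exact (S.adjoint.le_opNorm _).trans_eq (by rw [norm_V_apply])
  have hlim := tendsto_integral_filter_of_dominated_convergence (μ := γ) (l := atTop) (F := f)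
    (f := fun k => inner ℂ (V (ε • k) a) (S (V (ε • k) u)))
    (fun _ => (‖S.adjoint‖ * ‖a‖) ^ 2 + ‖u‖ ^ 2)
    (.of_forall fun s => (hfcont s).aestronglyMeasurable)
    (.of_forall fun s => .of_forall fun k => hbound s k) (integrable_const _)
    (.of_forall fun k => by
      have := b.hasSum_inner_mul_inner (S.adjoint (V (ε • k) a)) (V (ε • k) u)
      simp only [ContinuousLinearMap.adjoint_inner_left] at this
      exact this)
  have hzero (s : Finset w) : ∫ k, f s k ∂γ = 0 := by
    rw [integral_finsetSum]
    · exact Finset.sum_eq_zero fun j _ => hrank _ _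
    · intro j _
      have := hfcont {j}
      simp only [f, Finset.sum_singleton] at this
      refine (integrable_const ((‖S.adjoint‖ * ‖a‖) ^ 2 + ‖u‖ ^ 2)).mono'
        this.aestronglyMeasurable (.of_forall fun k => ?_)
      simpa [f] using hbound {j} k
  simp only [hzero] at hlim
  exact tendsto_nhds_unique hlim tendsto_const_nhds

/-- Lower semicontinuity of the `Lᵖ` norm: `L²` convergence implies convergence in measure. With the
convexity below, it lets `Lᵖ` bounds pass through integrals valued in `L²`. -/
lemma isClosed_setOf_eLpNorm_le (p c : ℝ≥0∞) :
    IsClosed {v : L2 n | eLpNorm v p volume ≤ c} := by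
  refine isClosed_of_closure_subset fun v hv => ?_
  obtain ⟨f, hf, hfv⟩ := mem_closure_iff_seq_limit.1 hv
  exact eLpNorm_le_of_tendstoInMeasure (.of_forall hf) (tendstoInMeasure_of_tendsto_Lp hfv)
    fun i => Lp.aestronglyMeasurable _

lemma convex_setOf_eLpNorm_le {p : ℝ≥0∞} (hp : 1 ≤ p) (c : ℝ≥0∞) :
    Convex ℝ {v : L2 n | eLpNorm v p volume ≤ c} := by
  intro v hv w hw a b ha hb hab
  simp only [Set.mem_ofPred_eq] at hv hw ⊢
  have h1 : eLpNorm (a • v + b • w : L2 n) p volume =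
      eLpNorm (a • (v : Euc n → ℂ) + b • (w : Euc n → ℂ)) p volume := by
    refine eLpNorm_congr_ae ?_
    filter_upwards [Lp.coeFn_add (a • v) (b • w), Lp.coeFn_smul a v, Lp.coeFn_smul b w]
      with x h1 h2 h3
    rw [h1, Pi.add_apply, h2, h3, Pi.add_apply]
  rw [h1]
  refine (eLpNorm_add_le ((Lp.aestronglyMeasurable v).const_smul a)
    ((Lp.aestronglyMeasurable w).const_smul b) hp).trans ?_
  rw [eLpNorm_const_smul, eLpNorm_const_smul]
  calc _ ≤ ‖a‖ₑ * c + ‖b‖ₑ * c := by gcongr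
    _ = c := by
      rw [← add_mul, Real.enorm_of_nonneg ha, Real.enorm_of_nonneg hb, ← ENNReal.ofReal_add ha hb,
        hab, ENNReal.ofReal_one, one_mul]

/-- An operator of class `C^u(Q)` which is bounded on `Lᵖ` is a norm limit of operators of finite
propagation which are bounded on `Lᵖ`. -/
lemma IsClassCu.exists_hasPropagation {S : L2 n →L[ℂ] L2 n} (hS : IsClassCu S) {p : ℝ≥0∞}
    (hp : 1 ≤ p) (hSp : BoundedOnLp p S) {δ : ℝ} (hδ : 0 < δ) :
    ∃ (T : L2 n →L[ℂ] L2 n) (R : ℝ), ‖S - T‖ ≤ δ ∧ BoundedOnLp p T ∧ HasPropagation R T := by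
  obtain ⟨γ, hγ, R, hR⟩ := exists_isProbabilityMeasure_charFun_eq_zero (Euc n)
  let W : Euc n → L2 n →L[ℂ] L2 n := fun k => V (-k) ∘L S ∘L V k
  have hWcont : Continuous W := hS
  have hWnorm (k : Euc n) : ‖W k‖ ≤ ‖S‖ := by
    refine ContinuousLinearMap.opNorm_le_bound _ (norm_nonneg _) fun u => ?_
    change ‖V (-k) (S (V k u))‖ ≤ _
    rw [norm_V_apply, ← norm_V_apply k u]
    exact S.le_opNorm _
  have hWc (ε : ℝ) : Continuous fun k => W (ε • k) := hWcont.comp (continuous_const_smul ε)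
  have hWint (ε : ℝ) : Integrable (fun k => W (ε • k)) γ :=
    (integrable_const ‖S‖).mono' (hWc ε).aestronglyMeasurable (.of_forall fun k => hWnorm _)
  -- Norm continuity at `k = 0` is used here: it makes the averages converge in operator norm.
  have hlim : Tendsto (fun ε : ℝ => ∫ k, W (ε • k) ∂γ) (𝓝[>] 0) (𝓝 (∫ _, W 0 ∂γ)) := by
    refine tendsto_integral_filter_of_dominated_convergence (fun _ => ‖S‖)
      (.of_forall fun ε => (hWc ε).aestronglyMeasurable)
      (.of_forall fun ε => .of_forall fun k => hWnorm _) (integrable_const _)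
      (.of_forall fun k => ?_)
    have : Tendsto (fun ε : ℝ => W (ε • k)) (𝓝 0) (𝓝 (W ((0 : ℝ) • k))) :=
      (hWcont.comp (continuous_id.smul continuous_const)).tendsto 0
    rw [zero_smul] at this
    exact this.mono_left nhdsWithin_le_nhds
  have hW0 : W 0 = S := by
    simp only [W, neg_zero, V_zero, ContinuousLinearMap.id_comp, ContinuousLinearMap.comp_id]
  rw [integral_const, probReal_univ, one_smul, hW0] at hlim
  obtain ⟨ε, hεS, hε⟩ :=
    ((hlim.eventually (Metric.closedBall_mem_nhds S hδ)).and self_mem_nhdsWithin).exists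
  have hε : 0 < ε := hε
  refine ⟨∫ k, W (ε • k) ∂γ, R / ε, ?_, ?_, ?_⟩
  · rw [← dist_eq_norm, dist_comm]
    exact hεS
  · obtain ⟨C, hC⟩ := hSp
    refine ⟨C, fun u hu => ?_⟩
    rw [ContinuousLinearMap.integral_apply (hWint ε)]
    -- An average for a probability measure stays in a closed convex set containing the integrand.
    refine (convex_setOf_eLpNorm_le hp (C * eLpNorm u p volume)).integral_mem
      (isClosed_setOf_eLpNorm_le p _) (.of_forall fun k => ?_)
      ((hWint ε).apply_continuousLinearMap u)
    change eLpNorm (V (-(ε • k)) (S (V (ε • k) u))) p volume ≤ _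
    rw [eLpNorm_V, ← eLpNorm_V (ε • k) u]
    exact hC _ ⟨Lp.aestronglyMeasurable _, by rw [eLpNorm_V]; exact hu.2⟩
  · intro A B hA hB hAB u hu
    set T := ∫ k, W (ε • k) ∂γ with hT
    -- Testing `T u` against `a = 1_A T u` gives `‖a‖² = ⟨a, T u⟩ = 0`.
    have hmem : MemLp (A.indicator (T u)) 2 volume := (Lp.memLp (T u)).indicator hA
    let a : L2 n := hmem.toLp
    have ha : a =ᵐ[volume] A.indicator (T u) := hmem.coeFn_toLp
    have hinner : inner ℂ a (T u) = 0 := by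
      rw [hT, ContinuousLinearMap.integral_apply (hWint ε), ← integral_inner
        ((hWint ε).apply_continuousLinearMap u)]
      rw [← integral_inner_V_eq_zero hR hε S hAB (a := a) (u := u) ?_ hu]
      · refine integral_congr_ae (.of_forall fun k => ?_)
        exact inner_V_neg _ _ _
      · filter_upwards [ha] with x hx hxA
        rw [hx, Set.indicator_of_notMem hxA]
    have haa : inner ℂ a a = 0 := by
      rw [← hinner, L2.inner_def, L2.inner_def]
      refine integral_congr_ae ?_
      filter_upwards [ha] with x hx
      rw [hx]
      by_cases hxA : x ∈ A <;> simp [hxA]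
    rw [inner_self_eq_zero] at haa
    have h0 := Lp.coeFn_zero ℂ 2 (volume : Measure (Euc n))
    rw [← haa] at h0
    filter_upwards [ha, h0] with x h1 h2 hxA
    rw [h2, Set.indicator_of_mem hxA] at h1
    exact h1.symm

end Propagation

variable {n : ℕ}

/-! ### Cubes -/

section Cubes

/-- The index of the unit cube with integral vertices which contains `x`. -/
def cubeIndex (x : Euc n) : Fin n → ℤ := fun j => ⌊x j⌋

/-- The lower corner of the unit cube with index `i`. -/
def corner (i : Fin n → ℤ) : Euc n := WithLp.toLp 2 fun j => (i j : ℝ)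

/-- The indices at distance at most `m` from `i`. -/
def nearIndices (m : ℕ) (i : Fin n → ℤ) : Finset (Fin n → ℤ) :=
  Finset.Icc (fun j => i j - m) (fun j => i j + m)

lemma mem_nearIndices {m : ℕ} {i k : Fin n → ℤ} :
    k ∈ nearIndices m i ↔ ∀ j, i j - m ≤ k j ∧ k j ≤ i j + m := by
  simp [nearIndices, Finset.mem_Icc, Pi.le_def, forall_and]

lemma mem_nearIndices_comm {m : ℕ} {i k : Fin n → ℤ} :
    k ∈ nearIndices m i ↔ i ∈ nearIndices m k := by
  simp only [mem_nearIndices]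
  exact forall_congr' fun j => ⟨fun h => by omega, fun h => by omega⟩

lemma card_nearIndices (m : ℕ) (i : Fin n → ℤ) : (nearIndices m i).card = (2 * m + 1) ^ n := by
  rw [nearIndices, Pi.card_Icc, Finset.prod_congr rfl (g := fun _ => 2 * m + 1)]
  · simp
  · intro j _
    rw [Int.card_Icc]
    omega

lemma measurable_cubeIndex : Measurable (cubeIndex (n := n)) :=
  measurable_pi_lambda _ fun j => Int.measurable_floor.comp (by fun_prop)

lemma cubeIndex_mem_nearIndices {m : ℕ} {x y : Euc n} (h : dist x y ≤ m) :
    cubeIndex y ∈ nearIndices m (cubeIndex x) := by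
  refine mem_nearIndices.2 fun j => ?_
  have h1 : |x j - y j| ≤ m := by
    have := PiLp.norm_apply_le (x - y) j
    rw [← dist_eq_norm] at this
    exact this.trans h
  rw [abs_le] at h1
  constructor
  · rw [cubeIndex, cubeIndex, ← Int.floor_sub_natCast]
    exact Int.floor_le_floor (by linarith)
  · rw [cubeIndex, cubeIndex, ← Int.floor_add_natCast]
    exact Int.floor_le_floor (by linarith)

lemma dist_corner_le {m : ℕ} {i : Fin n → ℤ} {y : Euc n} (h : cubeIndex y ∈ nearIndices m i) :
    dist y (corner i) ≤ √(n * (m + 1) ^ 2) := by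
  rw [EuclideanSpace.dist_eq]
  refine Real.sqrt_le_sqrt ?_
  refine (Finset.sum_le_card_nsmul _ _ (((m : ℝ) + 1) ^ 2) fun j _ => ?_).trans_eq (by simp)
  obtain ⟨h1, h2⟩ := mem_nearIndices.1 h j
  have h3 := Int.floor_le (y j)
  have h4 := Int.lt_floor_add_one (y j)
  simp only [cubeIndex] at h1 h2
  have h1 : (i j : ℝ) - m ≤ ⌊y j⌋ := by exact_mod_cast h1
  have h2 : (⌊y j⌋ : ℝ) ≤ i j + m := by exact_mod_cast h2
  rw [Real.dist_eq, sq_abs]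
  change (y j - (i j : ℝ)) ^ 2 ≤ _
  have : (0 : ℝ) ≤ m := by positivity
  exact sq_le_sq' (by linarith) (by linarith)

end Cubes

/-! ### Sets which are small with respect to `ν` -/

section NuSmall

variable {ν : Euc n → ℝ}

lemma exists_comparison (hν : ∀ a, 0 < ν a)
    (hcomp : ∀ r : ℝ, BddAbove {t : ℝ | ∃ a b, dist b a ≤ r ∧ t = ν b / ν a}) (r : ℝ) :
    ∃ C : ℝ, 0 < C ∧ ∀ a b, dist b a ≤ r → ν b ≤ C * ν a := by
  obtain ⟨C, hC⟩ := hcomp r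
  refine ⟨max C 1, by positivity, fun a b h => ?_⟩
  rw [← div_le_iff₀ (hν a)]
  exact (hC ⟨a, b, h, rfl⟩).trans (le_max_left _ _)

/-- The limsup gives the bound outside a compact set. On that set ν is bounded below by comparison
with `ν 0`, and the volume of the whole unit ball suffices. -/
lemma IsNuSmall.exists_volume_inter_ball_le {N : Set (Euc n)} (hN : IsNuSmall ν N)
    (hν : ∀ a, 0 < ν a)
    (hcomp : ∀ r : ℝ, BddAbove {t : ℝ | ∃ a b, dist b a ≤ r ∧ t = ν b / ν a}) :
    ∃ c : ℝ, 0 < c ∧ ∀ a, volume (N ∩ Metric.ball a 1) ≤ ENNReal.ofReal (c * ν a) := by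
  obtain ⟨c, hc⟩ := isNuSmall_iff.1 hN
  obtain ⟨K, hK, hKc⟩ := mem_cocompact.1 hc
  obtain ⟨r, hr⟩ := hK.isBounded.subset_closedBall 0
  obtain ⟨C, hC0, hC⟩ := exists_comparison hν hcomp r
  set v := (volume (Metric.ball (0 : Euc n) 1)).toReal with hv
  have hνpos := hν 0
  refine ⟨c + v / ν 0 * C + 1, by positivity, fun a => ?_⟩
  have hνa := hν a
  by_cases ha : a ∈ K
  · have h1 : ν 0 ≤ C * ν a := hC a 0 (by rw [dist_comm]; exact hr ha)
    calc volume (N ∩ Metric.ball a 1) ≤ volume (Metric.ball a 1) :=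
          measure_mono Set.inter_subset_right
      _ = ENNReal.ofReal v := by
          rw [Measure.addHaar_ball_center, hv, ENNReal.ofReal_toReal measure_ball_lt_top.ne]
      _ ≤ _ := by
          refine ENNReal.ofReal_le_ofReal ?_
          have h2 : v = v / ν 0 * ν 0 := by field_simp
          have h3 : v / ν 0 * ν 0 ≤ v / ν 0 * (C * ν a) := by gcongr
          have h4 : 0 ≤ (c + 1) * ν a := by positivity
          nlinarith
  · have h1 : volume (N ∩ Metric.ball a 1) / ENNReal.ofReal (ν a) ≤ c := hKc ha
    rw [ENNReal.div_le_iff (by simpa using hνa) ENNReal.ofReal_ne_top,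
      ← ENNReal.ofReal_coe_nnreal, ← ENNReal.ofReal_mul (by positivity)] at h1
    refine h1.trans (ENNReal.ofReal_le_ofReal ?_)
    gcongr
    have : 0 ≤ v / ν 0 * C := by positivity
    linarith

lemma IsNuSmall.exists_volume_inter_closedBall_le {N : Set (Euc n)} (hN : IsNuSmall ν N)
    (hν : ∀ a, 0 < ν a)
    (hcomp : ∀ r : ℝ, BddAbove {t : ℝ | ∃ a b, dist b a ≤ r ∧ t = ν b / ν a}) (ρ : ℝ) :
    ∃ c : ℝ, 0 < c ∧ ∀ a, volume (N ∩ Metric.closedBall a ρ) ≤ ENNReal.ofReal (c * ν a) := by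
  obtain ⟨c, hc0, hc⟩ := hN.exists_volume_inter_ball_le hν hcomp
  obtain ⟨t, hts, htf, ht⟩ := (isCompact_closedBall (0 : Euc n) ρ).finite_cover_balls one_pos
  obtain ⟨C, hC0, hC⟩ := exists_comparison hν hcomp ρ
  lift t to Finset (Euc n) using htf
  refine ⟨(t.card + 1) * (c * C), by positivity, fun a => ?_⟩
  have hνa := hν a
  have hsub : N ∩ Metric.closedBall a ρ ⊆ ⋃ z ∈ t, N ∩ Metric.ball (a + z) 1 := by
    rintro y ⟨hyN, hy⟩
    obtain ⟨z, hz, hyz⟩ := Set.mem_iUnion₂.1 (ht (by simpa [dist_eq_norm] using hy :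
      y - a ∈ Metric.closedBall 0 ρ))
    refine Set.mem_iUnion₂.2 ⟨z, hz, hyN, ?_⟩
    rw [Metric.mem_ball, dist_eq_norm] at hyz ⊢
    rwa [← sub_sub]
  calc volume (N ∩ Metric.closedBall a ρ) ≤ ∑ z ∈ t, volume (N ∩ Metric.ball (a + z) 1) :=
        (measure_mono hsub).trans (measure_biUnion_finset_le _ _)
    _ ≤ ∑ _z ∈ t, ENNReal.ofReal (c * C * ν a) := by
        refine Finset.sum_le_sum fun z hz => (hc _).trans (ENNReal.ofReal_le_ofReal ?_)
        rw [mul_assoc]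
        gcongr
        refine hC _ _ ?_
        have := hts hz
        simpa [dist_eq_norm] using this
    _ ≤ _ := by
        rw [Finset.sum_const, nsmul_eq_mul, ← ENNReal.ofReal_natCast,
          ← ENNReal.ofReal_mul (by positivity)]
        refine ENNReal.ofReal_le_ofReal ?_
        have : 0 < c * C * ν a := by positivity
        nlinarith

/-- A unit ball around `a` meets only cubes whose index is within 1 of that of `a`: at most `3 ^ n`
of them, with corners at bounded distance from `a`, so ν is comparable there. -/
lemma isNuSmall_iUnion_cubes (hν : ∀ a, 0 < ν a)
    (hcomp : ∀ r : ℝ, BddAbove {t : ℝ | ∃ a b, dist b a ≤ r ∧ t = ν b / ν a})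
    {E : (Fin n → ℤ) → Set (Euc n)} {c : ℝ} (hc : 0 ≤ c)
    (hE : ∀ i, volume (E i) ≤ ENNReal.ofReal (c * ν (corner i))) :
    IsNuSmall ν (⋃ i, E i ∩ cubeIndex ⁻¹' {i}) := by
  obtain ⟨C, hC0, hC⟩ := exists_comparison hν hcomp (√(n * ((1 : ℕ) + 1) ^ 2))
  refine isNuSmall_iff.2 ⟨Real.toNNReal ((2 * 1 + 1) ^ n * (c * C)), .of_forall fun a => ?_⟩
  have hνa := hν a
  rw [ENNReal.div_le_iff (by simpa using hνa) ENNReal.ofReal_ne_top]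
  have hsub : (⋃ i, E i ∩ cubeIndex ⁻¹' {i}) ∩ Metric.ball a 1 ⊆
      ⋃ i ∈ nearIndices 1 (cubeIndex a), E i := by
    rintro y ⟨hy, hya⟩
    obtain ⟨i, hyE, rfl⟩ := Set.mem_iUnion.1 hy
    refine Set.mem_iUnion₂.2 ⟨_, cubeIndex_mem_nearIndices ?_, hyE⟩
    rw [dist_comm, Nat.cast_one]
    exact (Metric.mem_ball.1 hya).le
  calc _ ≤ ∑ i ∈ nearIndices 1 (cubeIndex a), volume (E i) :=
        (measure_mono hsub).trans (measure_biUnion_finset_le _ _)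
    _ ≤ ∑ _i ∈ nearIndices 1 (cubeIndex a), ENNReal.ofReal (c * C * ν a) := by
        refine Finset.sum_le_sum fun i hi => (hE i).trans (ENNReal.ofReal_le_ofReal ?_)
        rw [mul_assoc]
        gcongr
        refine hC _ _ ?_
        rw [dist_comm]
        exact dist_corner_le (mem_nearIndices_comm.1 hi)
    _ = _ := by
        rw [Finset.sum_const, card_nearIndices, nsmul_eq_mul, ← ENNReal.ofReal_natCast,
          ← ENNReal.ofReal_mul (by positivity)]
        change _ = ENNReal.ofReal _ * _
        rw [← ENNReal.ofReal_mul (by positivity)]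
        congr 1
        push_cast
        ring

end NuSmall

/-! ### Multiplication operators -/

section MulOp

lemma norm_mulOp_apply_le {φ : Euc n → ℂ} (hφ : IsBoundedBorel φ) {C : ℝ}
    (hC : ∀ x, ‖φ x‖ ≤ C) (u : L2 n) : ‖mulOp φ hφ u‖ ≤ C * ‖u‖ := by
  refine Lp.norm_le_mul_norm_of_ae_le_mul ?_
  filter_upwards [coeFn_mulOp hφ u] with x hx
  rw [hx, norm_mul]
  gcongr
  exact hC x

lemma isBoundedBorel_indicator {D : Set (Euc n)} (hD : MeasurableSet D) :
    IsBoundedBorel (D.indicator (1 : Euc n → ℂ)) where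
  measurable := measurable_one.indicator hD
  bounded := ⟨1, fun x => by by_cases h : x ∈ D <;> simp [h]⟩

/-- The operator of multiplication by the characteristic function of `D`. -/
def restrictOp {D : Set (Euc n)} (hD : MeasurableSet D) : L2 n →L[ℂ] L2 n :=
  mulOp _ (isBoundedBorel_indicator hD)

lemma coeFn_restrictOp {D : Set (Euc n)} (hD : MeasurableSet D) (u : L2 n) :
    restrictOp hD u =ᵐ[volume] D.indicator u := by
  filter_upwards [coeFn_mulOp (isBoundedBorel_indicator hD) u] with x hx
  rw [restrictOp, hx]
  by_cases h : x ∈ D <;> simp [h]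

lemma norm_restrictOp_apply_le {D : Set (Euc n)} (hD : MeasurableSet D) (u : L2 n) :
    ‖restrictOp hD u‖ ≤ ‖u‖ := by
  refine (norm_mulOp_apply_le (C := 1) _ (fun x => ?_) u).trans_eq (one_mul _)
  by_cases h : x ∈ D <;> simp [h]

lemma restrictOp_add_compl {D : Set (Euc n)} (hD : MeasurableSet D) (u : L2 n) :
    restrictOp hD u + restrictOp hD.compl u = u := by
  apply Lp.ext
  filter_upwards [Lp.coeFn_add (restrictOp hD u) (restrictOp hD.compl u), coeFn_restrictOp hD u,
    coeFn_restrictOp hD.compl u] with x h1 h2 h3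
  rw [h1, Pi.add_apply, h2, h3, Set.indicator_self_add_compl_apply]

lemma enorm_sq_eq_lintegral (u : L2 n) : ‖u‖ₑ ^ 2 = ∫⁻ x, ‖u x‖ₑ ^ 2 := by
  have := eLpNorm_nnreal_pow_eq_lintegral (μ := volume) (f := (u : Euc n → ℂ)) (p := 2) two_ne_zero
  rw [Lp.enorm_def]
  simpa using this

lemma enorm_restrictOp_sq {D : Set (Euc n)} (hD : MeasurableSet D) (u : L2 n) :
    ‖restrictOp hD u‖ₑ ^ 2 = ∫⁻ x in D, ‖u x‖ₑ ^ 2 := by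
  rw [enorm_sq_eq_lintegral, ← lintegral_indicator hD]
  refine lintegral_congr_ae ?_
  filter_upwards [coeFn_restrictOp hD u] with x hx
  rw [hx]
  by_cases h : x ∈ D <;> simp [h]

end MulOp

/-! ### Operators of finite propagation -/

lemma lintegral_ofReal_norm_rpow_eq {p : ℝ≥0∞} (hp0 : p ≠ 0) (hp : p ≠ ∞) (u : L2 n) :
    ∫⁻ x, ENNReal.ofReal (‖u x‖ ^ p.toReal) = eLpNorm u p volume ^ p.toReal := by
  have h0 : 0 < p.toReal := ENNReal.toReal_pos hp0 hp
  rw [eLpNorm_eq_lintegral_rpow_enorm_toReal hp0 hp, ← ENNReal.rpow_mul,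
    one_div_mul_cancel h0.ne', ENNReal.rpow_one]
  refine lintegral_congr fun x => ?_
  rw [← ofReal_norm, ENNReal.ofReal_rpow_of_nonneg (norm_nonneg _) h0.le]

/-- Hölder's inequality on `D`; the power of `volume D` is the gain that makes the exceptional sets
proportional to `D`. -/
lemma eLpNorm_restrictOp_le {p : ℝ≥0∞} (hp : p ≤ 2) {D : Set (Euc n)} (hD : MeasurableSet D)
    (u : L2 n) :
    eLpNorm (restrictOp hD u) p volume ≤
      ENNReal.ofReal ‖u‖ * volume D ^ (1 / p.toReal - 1 / 2) := by
  rw [eLpNorm_congr_ae (coeFn_restrictOp hD u), eLpNorm_indicator_eq_eLpNorm_restrict hD]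
  refine (eLpNorm_le_eLpNorm_mul_rpow_measure_univ hp
    (Lp.aestronglyMeasurable u).restrict).trans ?_
  rw [Measure.restrict_apply_univ, ENNReal.toReal_ofNat, ofReal_norm, Lp.enorm_def]
  gcongr
  exact Measure.restrict_le_self

/-- If `T` is bounded on `Lᵖ` then `T 1_D`, considered as an operator in `L²`, has norm at most
`λ` outside of a set whose measure is controlled by that of `D`. -/
lemma BoundedOnLp.exists_exceptional_set {T : L2 n →L[ℂ] L2 n} {p : ℝ≥0∞} (hp1 : 1 ≤ p)
    (hp2 : p < 2) (hT : BoundedOnLp p T) {δ : ℝ} (hδ : 0 < δ) :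
    ∃ c : ℝ, 0 < c ∧ ∀ (D : Set (Euc n)) (hD : MeasurableSet D) (s : ℝ), 0 < s →
      volume D ≤ ENNReal.ofReal s → ∃ E, MeasurableSet E ∧ volume E ≤ ENNReal.ofReal (c * s) ∧
        ∀ u, ∫⁻ x in Eᶜ, ‖T (restrictOp hD u) x‖ₑ ^ 2 ≤ ENNReal.ofReal δ * ‖u‖ₑ ^ 2 := by
  obtain ⟨C, hC⟩ := hT
  have hp0 : p ≠ 0 := (zero_lt_one.trans_le hp1).ne'
  have hptop : p ≠ ∞ := (hp2.trans ENNReal.ofNat_lt_top).ne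
  set q := p.toReal with hq
  have hq0 : 0 < q := ENNReal.toReal_pos hp0 hptop
  have hq2 : q < 2 := by
    rw [hq, ← ENNReal.toReal_ofNat 2]
    exact (ENNReal.toReal_lt_toReal hptop ENNReal.ofNat_ne_top).2 hp2
  set r := 1 - q / 2 with hr
  have hr0 : 0 < r := by rw [hr]; linarith
  set A : ℝ := (C : ℝ) ^ q + 1 with hA
  have hA0 : 0 < A := by positivity
  -- Chosen so that `48 A τ ^ r = δ`, which is possible since `r > 0`, that is, `p < 2`.
  set τ : ℝ := (δ / (48 * A)) ^ (1 / r) with hτ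
  have hτ0 : 0 < τ := by positivity
  have hτr : 48 * A * τ ^ r = δ := by
    rw [hτ, ← Real.rpow_mul (by positivity), one_div_mul_cancel hr0.ne', Real.rpow_one]
    field_simp
  refine ⟨96 * A * τ ^ (-(q / 2)), by positivity, fun D hD s hs hDs => ?_⟩
  have hbound (u : L2 n) : ∫⁻ x, ENNReal.ofReal (‖(T ∘L restrictOp hD) u x‖ ^ q) ≤
      ENNReal.ofReal (A * s ^ r * ‖u‖ ^ q) := by
    have h1 := eLpNorm_restrictOp_le hp2.le hD u
    have he : 0 ≤ 1 / q - 1 / 2 := by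
      rw [sub_nonneg]
      exact one_div_le_one_div_of_le hq0 hq2.le
    have h2 : eLpNorm (restrictOp hD u) p volume ≤ ENNReal.ofReal (‖u‖ * s ^ (1 / q - 1 / 2)) := by
      rw [ENNReal.ofReal_mul (norm_nonneg _), ← ENNReal.ofReal_rpow_of_nonneg hs.le he]
      refine h1.trans ?_
      gcongr
    have h3 := hC (restrictOp hD u) ⟨Lp.aestronglyMeasurable _,
      h2.trans_lt ENNReal.ofReal_lt_top⟩
    rw [lintegral_ofReal_norm_rpow_eq hp0 hptop]
    calc eLpNorm (T (restrictOp hD u)) p volume ^ q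
        ≤ ENNReal.ofReal (C * (‖u‖ * s ^ (1 / q - 1 / 2))) ^ q := by
          rw [ENNReal.ofReal_mul C.coe_nonneg, ENNReal.ofReal_coe_nnreal]
          gcongr
          exact h3.trans (by gcongr)
      _ = ENNReal.ofReal ((C : ℝ) ^ q * s ^ r * ‖u‖ ^ q) := by
          rw [ENNReal.ofReal_rpow_of_nonneg (by positivity) hq0.le,
            Real.mul_rpow C.coe_nonneg (by positivity), Real.mul_rpow (norm_nonneg _) (by positivity),
            ← Real.rpow_mul hs.le]
          have : (1 / q - 1 / 2) * q = r := by rw [hr]; field_simp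
          rw [this]
          ring_nf
      _ ≤ _ := by
          refine ENNReal.ofReal_le_ofReal ?_
          gcongr
          linarith
  -- At level `t = τ / s` with `K = A s ^ r`, the powers of `s` cancel in the `L²` bound and combine
  -- to `s ^ (r + q / 2) = s` in the measure of `E`.
  obtain ⟨E, hE, hμE, hEu⟩ := exists_small_set_integral_sq_le (T ∘L restrictOp hD) hq0 hq2.le
    (by positivity) hbound (t := τ / s) (by positivity)
  refine ⟨E, hE, hμE.trans_eq ?_, fun u => ?_⟩
  · congr 1
    rw [Real.div_rpow hτ0.le hs.le, Real.rpow_neg hs.le, div_inv_eq_mul]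
    have : s ^ r * s ^ (q / 2) = s := by
      rw [← Real.rpow_add hs, hr]
      simp
    linear_combination 96 * A * τ ^ (-(q / 2)) * this
  · have h1 := hEu u
    have h2 : 48 * (A * s ^ r) * (τ / s) ^ r = δ := by
      rw [Real.div_rpow hτ0.le hs.le, ← hτr]
      have : s ^ r ≠ 0 := by positivity
      field_simp
    rw [h2] at h1
    have h3 : Integrable (fun x => ‖(T ∘L restrictOp hD) u x‖ ^ 2) (volume.restrict Eᶜ) :=
      ((Lp.memLp ((T ∘L restrictOp hD) u)).integrable_norm_pow (p := 2) two_ne_zero).integrableOn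
    calc _ = ∫⁻ x in Eᶜ, ENNReal.ofReal (‖(T ∘L restrictOp hD) u x‖ ^ 2) := by
          refine lintegral_congr fun x => ?_
          rw [ENNReal.ofReal_pow (norm_nonneg _), ofReal_norm]
          rfl
      _ = ENNReal.ofReal (∫ x in Eᶜ, ‖(T ∘L restrictOp hD) u x‖ ^ 2) :=
          (ofReal_integral_eq_lintegral_ofReal h3 (.of_forall fun _ => by positivity)).symm
      _ ≤ ENNReal.ofReal (δ * ‖u‖ ^ 2) := ENNReal.ofReal_le_ofReal h1
      _ = _ := by rw [ENNReal.ofReal_mul hδ.le, ENNReal.ofReal_pow (norm_nonneg _), ofReal_norm]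

/-- The union of the cubes with index near `i`. -/
def nearCubes (m : ℕ) (i : Fin n → ℤ) : Set (Euc n) := cubeIndex ⁻¹' (nearIndices m i)

lemma measurableSet_nearCubes (m : ℕ) (i : Fin n → ℤ) : MeasurableSet (nearCubes m i) :=
  measurable_cubeIndex (Finset.measurableSet _)

/-- Each point lies in exactly `(2m + 1) ^ n` of the enlarged cubes. -/
lemma tsum_lintegral_nearCubes (m : ℕ) {f : Euc n → ℝ≥0∞} (hf : AEMeasurable f) :
    ∑' i, ∫⁻ x in nearCubes m i, f x = (2 * m + 1) ^ n * ∫⁻ x, f x := by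
  classical
  simp_rw [← lintegral_indicator (measurableSet_nearCubes m _)]
  rw [← lintegral_tsum fun i => hf.indicator (measurableSet_nearCubes m i),
    ← lintegral_const_mul'' _ hf]
  refine lintegral_congr fun x => ?_
  have h (i : Fin n → ℤ) : (nearCubes m i).indicator f x =
      if i ∈ nearIndices m (cubeIndex x) then f x else 0 := by
    rw [Set.indicator_apply]
    refine if_congr ?_ rfl rfl
    rw [mem_nearIndices_comm]
    exact Iff.rfl
  simp_rw [h]
  rw [tsum_eq_sum (s := nearIndices m (cubeIndex x)) fun i hi => if_neg hi,
    Finset.sum_congr rfl fun i hi => if_pos hi, Finset.sum_const, card_nearIndices, nsmul_eq_mul]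
  push_cast
  rfl

/-- Locality of the operators of finite propagation. -/
lemma HasPropagation.restrictOp_nearCubes {R : ℝ} {m : ℕ} {T : L2 n →L[ℂ] L2 n}
    (hT : HasPropagation R T) (hm : R ≤ m) {N : Set (Euc n)} (hN : MeasurableSet N)
    (i : Fin n → ℤ) (u : L2 n) : ∀ᵐ x, x ∈ cubeIndex ⁻¹' {i} →
      T (restrictOp hN u) x = T (restrictOp (hN.inter (measurableSet_nearCubes m i))
        (restrictOp (measurableSet_nearCubes m i) u)) x := by
  -- The restriction is doubled on purpose: the outer one supplies the small set `D`, the inner one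
  -- keeps the norm of `u` local so that the estimates can be summed over cubes.
  set w := restrictOp (hN.inter (measurableSet_nearCubes m i))
    (restrictOp (measurableSet_nearCubes m i) u)
  have h1 := hT (cubeIndex ⁻¹' {i}) (nearCubes m i)ᶜ
    (measurable_cubeIndex (measurableSet_singleton i)) (measurableSet_nearCubes m i).compl
    (by
      rintro x rfl y hy
      by_contra! hlt
      exact hy (cubeIndex_mem_nearIndices (hlt.le.trans hm)))
    (restrictOp hN u - w) (by
      filter_upwards [Lp.coeFn_sub (restrictOp hN u) w, coeFn_restrictOp hN u,
        coeFn_restrictOp (hN.inter (measurableSet_nearCubes m i))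
          (restrictOp (measurableSet_nearCubes m i) u),
        coeFn_restrictOp (measurableSet_nearCubes m i) u] with x h1 h2 h3 h4 hx
      have hx : x ∈ nearCubes m i := not_not.1 hx
      rw [h1, Pi.sub_apply, h2, h3]
      by_cases hxN : x ∈ N <;> simp [hxN, hx, h4])
  rw [map_sub] at h1
  filter_upwards [h1, Lp.coeFn_sub (T (restrictOp hN u)) (T w)] with x h1 h2 hx
  have := h1 hx
  rwa [h2, Pi.sub_apply, sub_eq_zero] at this

/-- An operator of finite propagation which is bounded on `Lᵖ` maps functions supported by a
`ν`-small set, up to a small error, to functions supported by a `ν`-small set. -/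
lemma HasPropagation.exists_isNuSmall {ν : Euc n → ℝ} (hν : ∀ a, 0 < ν a)
    (hcomp : ∀ r : ℝ, BddAbove {t : ℝ | ∃ a b, dist b a ≤ r ∧ t = ν b / ν a})
    {T : L2 n →L[ℂ] L2 n} {R : ℝ} (hT : HasPropagation R T) {p : ℝ≥0∞} (hp1 : 1 ≤ p)
    (hp2 : p < 2) (hTp : BoundedOnLp p T) {N : Set (Euc n)} (hNm : MeasurableSet N)
    (hN : IsNuSmall ν N) {δ : ℝ} (hδ : 0 < δ) :
    ∃ (N' : Set (Euc n)) (hN' : MeasurableSet N'), IsNuSmall ν N' ∧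
      ∀ u, ‖restrictOp hN'.compl (T (restrictOp hNm u))‖ ≤ δ * ‖u‖ := by
  obtain ⟨m, hm⟩ := exists_nat_ge R
  -- The overlap number of the enlarged cubes: an error `δ ^ 2 / κ` on each cube sums to `δ ^ 2`.
  set κ : ℝ := (2 * m + 1) ^ n with hκ
  have hκ0 : 0 < κ := by positivity
  obtain ⟨c, hc0, hc⟩ := hN.exists_volume_inter_closedBall_le hν hcomp (√(n * (m + 1) ^ 2))
  obtain ⟨c', hc'0, hc'⟩ := hTp.exists_exceptional_set hp1 hp2 (δ := δ ^ 2 / κ) (by positivity)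
  have hvol (i : Fin n → ℤ) : volume (N ∩ nearCubes m i) ≤ ENNReal.ofReal (c * ν (corner i)) :=
    (measure_mono (Set.inter_subset_inter_right _ fun y hy => dist_corner_le hy)).trans (hc _)
  have hpos (i : Fin n → ℤ) : 0 < c * ν (corner i) := mul_pos hc0 (hν _)
  choose E hE hμE hEu using fun i => hc' (N ∩ nearCubes m i)
    (hNm.inter (measurableSet_nearCubes m i)) _ (hpos i) (hvol i)
  have hK (i : Fin n → ℤ) : MeasurableSet (cubeIndex (n := n) ⁻¹' {i}) :=
    measurable_cubeIndex (measurableSet_singleton i)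
  set N' : Set (Euc n) := ⋃ i, E i ∩ cubeIndex ⁻¹' {i} with hN'
  have hN'm : MeasurableSet N' := .iUnion fun i => (hE i).inter (hK i)
  refine ⟨N', hN'm, isNuSmall_iUnion_cubes hν hcomp (c := c' * c) (by positivity) fun i =>
    (hμE i).trans_eq (by rw [mul_assoc]), fun u => ?_⟩
  have hcover : N'ᶜ = ⋃ i, N'ᶜ ∩ cubeIndex ⁻¹' {i} := by
    rw [← Set.inter_iUnion, ← Set.preimage_iUnion, Set.iUnion_of_singleton, Set.preimage_univ,
      Set.inter_univ]
  have hcube (i : Fin n → ℤ) :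
      ∫⁻ x in N'ᶜ ∩ cubeIndex ⁻¹' {i}, ‖T (restrictOp hNm u) x‖ₑ ^ 2 ≤
        ENNReal.ofReal (δ ^ 2 / κ) * ∫⁻ x in nearCubes m i, ‖u x‖ₑ ^ 2 := by
    set w := restrictOp (measurableSet_nearCubes m i) u with hw
    calc _ = ∫⁻ x in N'ᶜ ∩ cubeIndex ⁻¹' {i},
          ‖T (restrictOp (hNm.inter (measurableSet_nearCubes m i)) w) x‖ₑ ^ 2 := by
          refine setLIntegral_congr_fun_ae (hN'm.compl.inter (hK i)) ?_
          filter_upwards [hT.restrictOp_nearCubes hm hNm i u] with x hx hxi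
          rw [hx hxi.2]
      _ ≤ ∫⁻ x in (E i)ᶜ,
          ‖T (restrictOp (hNm.inter (measurableSet_nearCubes m i)) w) x‖ₑ ^ 2 := by
          refine lintegral_mono_set ?_
          rintro x ⟨hxN, hxi⟩ hxE
          exact hxN (Set.mem_iUnion.2 ⟨i, hxE, hxi⟩)
      _ ≤ ENNReal.ofReal (δ ^ 2 / κ) * ‖w‖ₑ ^ 2 := hEu i w
      _ = _ := by rw [hw, enorm_restrictOp_sq]
  have hmeas : AEMeasurable (fun x => ‖u x‖ₑ ^ 2) volume :=
    (Lp.aestronglyMeasurable u).enorm.pow_const 2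
  have hκ' : ((2 * m + 1) ^ n : ℝ≥0∞) = ENNReal.ofReal κ := by
    rw [hκ, ENNReal.ofReal_pow (by positivity), ENNReal.ofReal_add (by positivity) zero_le_one,
      ENNReal.ofReal_mul zero_le_two]
    simp
  have hsq : ‖restrictOp hN'm.compl (T (restrictOp hNm u))‖ₑ ^ 2 ≤
      ENNReal.ofReal ((δ * ‖u‖) ^ 2) := by
    calc _ = ∫⁻ x in N'ᶜ, ‖T (restrictOp hNm u) x‖ₑ ^ 2 := enorm_restrictOp_sq _ _
      _ = ∫⁻ x in ⋃ i, N'ᶜ ∩ cubeIndex ⁻¹' {i}, ‖T (restrictOp hNm u) x‖ₑ ^ 2 := by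
          rw [← hcover]
      _ ≤ ∑' i, ∫⁻ x in N'ᶜ ∩ cubeIndex ⁻¹' {i}, ‖T (restrictOp hNm u) x‖ₑ ^ 2 :=
          lintegral_iUnion_le _ _
      _ ≤ ∑' i, ENNReal.ofReal (δ ^ 2 / κ) * ∫⁻ x in nearCubes m i, ‖u x‖ₑ ^ 2 :=
          ENNReal.tsum_le_tsum hcube
      _ = ENNReal.ofReal ((δ * ‖u‖) ^ 2) := by
          rw [ENNReal.tsum_mul_left, tsum_lintegral_nearCubes m hmeas, ← enorm_sq_eq_lintegral, hκ',
            ← ofReal_norm, ← ENNReal.ofReal_pow (norm_nonneg _), ← ENNReal.ofReal_mul hκ0.le,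
            ← ENNReal.ofReal_mul (by positivity)]
          congr 1
          field_simp
  rw [← ofReal_norm, ← ENNReal.ofReal_pow (norm_nonneg _),
    ENNReal.ofReal_le_ofReal_iff (by positivity)] at hsq
  exact (sq_le_sq₀ (norm_nonneg _) (by positivity)).1 hsq

lemma tendsto_indicator_nuFilter {ν : Euc n → ℝ} {N : Set (Euc n)} (hN : IsNuSmall ν N) :
    Tendsto (N.indicator (1 : Euc n → ℂ)) (nuFilter ν) (𝓝 0) := by
  refine tendsto_const_nhds.congr' ?_
  have : Nᶜ ∈ nuFilter ν := by
    change IsNuSmall ν _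
    rwa [compl_compl]
  filter_upwards [this] with x hx
  rw [Set.indicator_of_notMem hx]

end WeakDecay

end

/-! ### Left decay preservation: assembling the estimates -/

theorem theorem6p5 (n : ℕ) (ν : WeakDecay.Euc n → ℝ) (hν : ∀ a, 0 < ν a)
    (hν_liminf : liminf (fun a => ENNReal.ofReal (ν a)) (cocompact (WeakDecay.Euc n)) = 0)
    (hν_comp : ∀ r : ℝ, BddAbove {t : ℝ | ∃ a b, dist b a ≤ r ∧ t = ν b / ν a})
    (S : WeakDecay.L2 n →L[ℂ] WeakDecay.L2 n) (hS : WeakDecay.IsClassCu S)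
    (p : ℝ≥0∞) (hp1 : 1 ≤ p) (hp2 : p < 2) (hSp : WeakDecay.BoundedOnLp p S) :
    WeakDecay.LeftFilterDecayPreserving (WeakDecay.nuFilter ν) S := by
  open WeakDecay in
  rintro _ ⟨φ, hφ, hφlim, rfl⟩
  obtain ⟨C, hC⟩ := hφ.bounded
  refine Metric.mem_closure_iff.2 fun ε hε => ?_
  have hC0 : 0 ≤ C := (norm_nonneg _).trans (hC 0)
  -- The three errors below add up to `δ (‖S‖ + 2 C)`; the `+ 1` keeps the denominator positive.
  set δ : ℝ := ε / (2 * (‖S‖ + 2 * C + 1)) with hδ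
  have hden : 0 < 2 * (‖S‖ + 2 * C + 1) := by positivity
  have hδ0 : 0 < δ := by positivity
  have hNm : MeasurableSet {x | δ ≤ ‖φ x‖} := measurableSet_le measurable_const hφ.measurable.norm
  have hN : IsNuSmall ν {x | δ ≤ ‖φ x‖} := by
    have h : {x | δ ≤ ‖φ x‖}ᶜ ∈ nuFilter ν := by
      filter_upwards [hφlim (Metric.ball_mem_nhds 0 hδ0)] with x hx
      simpa using hx
    have h' : IsNuSmall ν {x | δ ≤ ‖φ x‖}ᶜᶜ := h
    rwa [compl_compl] at h'
  obtain ⟨T, R, hST, hTp, hTR⟩ := hS.exists_hasPropagation hp1 hSp hδ0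
  obtain ⟨N', hN'm, hN', hTN⟩ := hTR.exists_isNuSmall hν hν_comp hp1 hp2 hTp hNm hN hδ0
  refine ⟨restrictOp hN'm ∘L (T ∘L restrictOp hNm ∘L mulOp φ hφ), Submodule.subset_span
    ⟨_, ⟨_, isBoundedBorel_indicator hN'm, tendsto_indicator_nuFilter hN', rfl⟩, _, rfl⟩, ?_⟩
  rw [dist_eq_norm]
  refine (ContinuousLinearMap.opNorm_le_bound _ (M := δ * (‖S‖ + 2 * C)) (by positivity)
    fun u => ?_).trans_lt ?_
  · set v := mulOp φ hφ u with hv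
    have hvC : ‖v‖ ≤ C * ‖u‖ := norm_mulOp_apply_le hφ hC u
    have h1 : ‖restrictOp hNm.compl v‖ ≤ δ * ‖u‖ := by
      refine Lp.norm_le_mul_norm_of_ae_le_mul ?_
      filter_upwards [coeFn_restrictOp hNm.compl v, coeFn_mulOp hφ u] with x h1 h2
      rw [h1]
      by_cases hx : δ ≤ ‖φ x‖
      · rw [Set.indicator_of_notMem (by simpa using hx), norm_zero]
        positivity
      · rw [Set.indicator_of_mem (by simpa using hx), hv, h2, norm_mul]
        gcongr
        exact (not_le.1 hx).le
    -- The errors come from the small values of `φ`, from replacing `S` by `T`, and from cutting `T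
    -- 1_N` down to `N'`.
    have h2 : (S ∘L mulOp φ hφ - restrictOp hN'm ∘L (T ∘L restrictOp hNm ∘L mulOp φ hφ)) u =
        S (restrictOp hNm.compl v) + (S - T) (restrictOp hNm v) +
          restrictOp hN'm.compl (T (restrictOp hNm v)) := by
      have h3 := congrArg S (restrictOp_add_compl hNm v)
      have h4 := restrictOp_add_compl hN'm (T (restrictOp hNm v))
      rw [map_add] at h3
      change S v - restrictOp hN'm (T (restrictOp hNm v)) = S (restrictOp hNm.compl v) +
        (S (restrictOp hNm v) - T (restrictOp hNm v)) + _
      rw [← h3, eq_sub_of_add_eq h4]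
      abel
    rw [h2]
    calc _ ≤ ‖S‖ * (δ * ‖u‖) + δ * (C * ‖u‖) + δ * (C * ‖u‖) := by
          refine (norm_add₃_le).trans (add_le_add (add_le_add ?_ ?_) ?_)
          · exact (S.le_opNorm _).trans (by gcongr)
          · exact ((S - T).le_opNorm _).trans (mul_le_mul hST
              ((norm_restrictOp_apply_le hNm v).trans hvC) (norm_nonneg _) hδ0.le)
          · exact (hTN v).trans (by gcongr)
      _ = _ := by ring
  · rw [hδ, div_mul_eq_mul_div, div_lt_iff₀ hden]
    have := norm_nonneg S
    nlinarith
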